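/- Let $\Omega\subset\mathbb{R}^3$ be the convex hull of the two disks $$D_1=\{(x,y,z): x^2+y^2\le 1,\ z=-1\},\qquad D_2=\{(x,y,z): x^2+z^2\le 1,\ y=1\},$$ and let $AR_2=\int_{\partial\Omega}dS$ be its surface area, i.e. the two-dimensional Hausdorff measure of $\partial\Omega$, normalised to agree with Lebesgue measure in the plane. Let $E(\mu)=\int_0^{\pi/2}\sqrt{1-\mu\sin^2\theta}\,d\theta$ be the complete elliptic integral of the second kind. Then $$AR_2 = 2\left(\pi+2\sqrt2\,E\!\left(\tfrac12\right)\right)=13.9235808852350105127348109\ldots$$ Moreover, this value is given by each of the following two descriptions of $\partial\Omega$. (i) (Graph description.) Put $\varphi(x,y)=\sqrt{1-x^2}+y-1$ on $\{|x|\le1,\ |y|\le 1,\ y\ge-\sqrt{1-x^2}\}$ and $\psi(x,y)=-\sqrt{1-x^2}+y-1$ on $\{|x|\le1,\ |y|\le1,\ y\ge\sqrt{1-x^2}\}$, and let $C$ be the union of the graphs $z=\varphi(x,y)$ and $z=\psi(x,y)$ over these regions. Then $\partial\Omega=D_1\cup D_2\cup C$, the area elements $\sqrt{1+\varphi_x^2+\varphi_y^2}$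 and $\sqrt{1+\psi_x^2+\psi_y^2}$ are integrable over these regions, and $$AR_2=2\pi+\int_{-1}^1\int_{-\sqrt{1-x^2}}^1\sqrt{1+\varphi_x^2+\varphi_y^2}\,dy\,dx+\int_{-1}^1\int_{\sqrt{1-x^2}}^1\sqrt{1+\psi_x^2+\psi_y^2}\,dy\,dx = 2\left(\pi+2\sqrt2\,E\!\left(\tfrac12\right)\right).$$ (ii) (Vinzant's parametrization.) The map $$(u,v)\mapsto\left(\sqrt{1-v^2},\ 1-u+uv,\ -u-v+uv\right),\qquad 0\le u\le1,\ -1\le v\le1,$$ has image $C\cap\{x\ge0\}$. Denote the coefficients of its first fundamental form by $\mathsf E,\mathsf F,\mathsf G$. Then $\mathsf E\mathsf G-\mathsf F^2=\frac{(1-v)(1+v^2)}{1+v}$ for $0\le u\le 1$, $-1<v<1$, the function $\sqrt{\mathsf E\mathsf G-\mathsf F^2}$ is integrable over $[0,1]\times[-1,1]$, and $$AR_2=2\pi+2\int_0^1\int_{-1}^1\sqrt{\mathsf E\mathsf G-\mathsf F^2}\,dv\,du=2\pi+2\int_0^1\int_{-1}^1\sqrt{\frac{(1-v)(1+v^2)}{1+v}}\,dv\,du=2\left(\pi+2\sqrt2\,E\!\left(\tfrac12\right)\right).$$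 -/

import Mathlib

open Real Set MeasureTheory
open scoped ENNReal

noncomputable section

namespace TwoDisks

/-- The horizontal unit disk `x² + y² ≤ 1`, `z = -1`; coordinates are `x = p 0`, `y = p 1`,
`z = p 2`. -/
def diskXY : Set (EuclideanSpace ℝ (Fin 3)) :=
  {p | p 0 ^ 2 + p 1 ^ 2 ≤ 1 ∧ p 2 = -1}

/-- The vertical unit disk `x² + z² ≤ 1`, `y = 1`. -/
def diskXZ : Set (EuclideanSpace ℝ (Fin 3)) :=
  {p | p 0 ^ 2 + p 2 ^ 2 ≤ 1 ∧ p 1 = 1}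

/-- The convex hull of the two disks. -/
def body : Set (EuclideanSpace ℝ (Fin 3)) :=
  convexHull ℝ (diskXY ∪ diskXZ)

/-- The surface area of a solid: the two-dimensional Hausdorff measure of its boundary,
normalised so that it agrees with Lebesgue measure in the Euclidean plane. -/
def surfaceArea (K : Set (EuclideanSpace ℝ (Fin 3))) : ℝ≥0∞ :=
  Measure.euclideanHausdorffMeasure 2 (frontier K)

/-- The complete elliptic integral of the second kind, as a function of the parameter `m`
(the square of the modulus). -/
def ellipticE (m : ℝ) : ℝ :=
  ∫ θ in (0 : ℝ)..(π / 2), √(1 - m * sin θ ^ 2)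

def phi (x y : ℝ) : ℝ := √(1 - x ^ 2) + y - 1

def psi (x y : ℝ) : ℝ := -√(1 - x ^ 2) + y - 1

/-- The planar region over which the curved portion `z = φ(x, y)` lies. -/
def phiDomain : Set (ℝ × ℝ) :=
  {q | |q.1| ≤ 1 ∧ |q.2| ≤ 1 ∧ -√(1 - q.1 ^ 2) ≤ q.2}

/-- The planar region over which the curved portion `z = ψ(x, y)` lies. -/
def psiDomain : Set (ℝ × ℝ) :=
  {q | |q.1| ≤ 1 ∧ |q.2| ≤ 1 ∧ √(1 - q.1 ^ 2) ≤ q.2}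

/-- The surface in space that is the graph of `f` over the planar region `D`. -/
def graphOver (f : ℝ → ℝ → ℝ) (D : Set (ℝ × ℝ)) : Set (EuclideanSpace ℝ (Fin 3)) :=
  {p | (p 0, p 1) ∈ D ∧ p 2 = f (p 0) (p 1)}

/-- The curved portion of the boundary. -/
def curved : Set (EuclideanSpace ℝ (Fin 3)) :=
  graphOver phi phiDomain ∪ graphOver psi psiDomain

/-- The area element `√(1 + f_x² + f_y²)` of the graph `z = f(x, y)`. -/
def graphAreaElement (f : ℝ → ℝ → ℝ) (x y : ℝ) : ℝ :=
  √(1 + deriv (fun s => f s y) x ^ 2 + deriv (fun t => f x t) y ^ 2)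

/-- Vinzant's parametrisation of the half `x ≥ 0` of the curved portion. -/
def param (u v : ℝ) : EuclideanSpace ℝ (Fin 3) :=
  !₂[√(1 - v ^ 2), 1 - u + u * v, -u - v + u * v]

def paramU (u v : ℝ) : EuclideanSpace ℝ (Fin 3) := deriv (fun s => param s v) u

def paramV (u v : ℝ) : EuclideanSpace ℝ (Fin 3) := deriv (fun t => param u t) v

/-- The coefficients of the first fundamental form of the parametrisation. -/
def coeffE (u v : ℝ) : ℝ := inner ℝ (paramU u v) (paramU u v)

def coeffF (u v : ℝ) : ℝ := inner ℝ (paramU u v) (paramV u v)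

def coeffG (u v : ℝ) : ℝ := inner ℝ (paramV u v) (paramV u v)

/-- The area element `√(EG - F²)` of the parametrisation. -/
def paramAreaElement (u v : ℝ) : ℝ :=
  √(coeffE u v * coeffG u v - coeffF u v ^ 2)

end TwoDisks

end

/-! Both disks are sections of the elliptic cylinder `x² + (z - y + 1)² ≤ 1`, whose rulings have
direction `(0, 1, 1)`, so the hull is the part of this cylinder with `z ≥ -1` and `y ≤ 1`
(`body_eq`). Its boundary is the two disks and the lateral surface (`frontier_body`), which overlap
only in null sets.

A section perpendicular to the rulings is an ellipse with semi-axes `1` and `1/√2`, traversed with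
speed `√(1 - sin² t / 2)`; the ruling at angle `t` has length `√2 (1 + cos t)`. The cosine term
cancels between opposite halves of the ellipse, leaving `4√2 E(1/2)` (`integral_curved`).

The Hausdorff measure of the lateral surface comes from an area formula proved directly
(`measure_cyl_image`): on a strip of angular width `δ` the cylinder map is bi-Lipschitz to a linear
stretch with constant tending to `1`, and the strips are summed before `δ → 0`.

The substitutions `x = sin t` and `v = sin t` turn the graph and Vinzant integrals into integrals of
continuous functions with the same value. The digits come from the binomial series of `√(1 + cos x /
3)` and Machin's formula. -/

noncomputable section

namespace TwoDisks

open Measure Filter Topology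

/-! ### The area formula on an elliptic cylinder -/

/-- If distances between images under `f` are at most `K` times those under `g`, then so are the
Hausdorff measures, up to the factor `K ^ d`. -/
theorem euclideanHausdorffMeasure_image_le_of_edist_le {X Y Z : Type*} [EMetricSpace Y]
    [MeasurableSpace Y] [BorelSpace Y] [EMetricSpace Z] [MeasurableSpace Z] [BorelSpace Z]
    {f : X → Y} {g : X → Z} {A : Set X} {K : NNReal} (d : ℕ)
    (h : ∀ p ∈ A, ∀ q ∈ A, edist (f p) (f q) ≤ K * edist (g p) (g q)) :
    euclideanHausdorffMeasure d (f '' A) ≤ (K : ℝ≥0∞) ^ d * euclideanHausdorffMeasure d (g '' A) := by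
  rcases A.eq_empty_or_nonempty with rfl | ⟨a, ha⟩
  · simp
  have : Nonempty X := ⟨a⟩
  have hinv : ∀ z ∈ g '' A, Function.invFunOn g A z ∈ A ∧ g (Function.invFunOn g A z) = z :=
    fun z hz => ⟨Function.invFunOn_mem hz, Function.invFunOn_eq hz⟩
  have hL : LipschitzOnWith K (f ∘ Function.invFunOn g A) (g '' A) := by
    intro z hz w hw
    have := h _ (hinv z hz).1 _ (hinv w hw).1
    rwa [(hinv z hz).2, (hinv w hw).2] at this
  -- `g` need not be injective: points with equal image under `g` are at distance zero under `f`, so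
  -- the chosen preimage does not matter.
  have himg : f '' A = (f ∘ Function.invFunOn g A) '' (g '' A) := by
    rw [image_image]
    refine image_congr fun p hp => ?_
    have hz := hinv (g p) (mem_image_of_mem g hp)
    have := h p hp _ hz.1
    rw [hz.2, edist_self, mul_zero, nonpos_iff_eq_zero, edist_eq_zero] at this
    exact this
  have := hL.hausdorffMeasure_image_le (d := d) (Nat.cast_nonneg d)
  rw [← himg] at this
  simp only [euclideanHausdorffMeasure_def, Measure.smul_apply, ENNReal.smul_def, smul_eq_mul]
  rw [mul_left_comm]
  gcongr
  simpa using this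

/-- The elliptic cylinder `x² + (z - y + 1)² = 1`, parametrised by the angle `t` of the directrix
and the arc length `s` along the rulings. -/
def cyl (p : EuclideanSpace ℝ (Fin 2)) : EuclideanSpace ℝ (Fin 3) :=
  !₂[sin (p 0), (√2 * p 1 - cos (p 0) + 1) / 2, (√2 * p 1 + cos (p 0) - 1) / 2]

/-- The speed of the directrix of the cylinder. -/
def speed (t : ℝ) : ℝ := √(1 - sin t ^ 2 / 2)

theorem half_le_speed_sq (t : ℝ) : 1 / 2 ≤ 1 - sin t ^ 2 / 2 := by
  nlinarith [sin_sq_le_one t]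

theorem speed_sq (t : ℝ) : speed t ^ 2 = 1 - sin t ^ 2 / 2 :=
  sq_sqrt (by linarith [half_le_speed_sq t])

theorem speed_nonneg (t : ℝ) : 0 ≤ speed t := sqrt_nonneg _

theorem continuous_speed : Continuous speed := by
  unfold speed; fun_prop

theorem continuous_cyl : Continuous cyl := by
  refine (PiLp.continuous_toLp 2 _).comp (continuous_pi fun i => ?_)
  fin_cases i <;> simp <;> fun_prop

/-- Sum-to-product makes the chord exact: it is governed by the speed at the mean angle. Comparison
with a flat metric then only needs bounds on `sin` and on `speed`. -/
theorem dist_cyl_sq (p q : EuclideanSpace ℝ (Fin 2)) :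
    dist (cyl p) (cyl q) ^ 2 =
      4 * sin ((p 0 - q 0) / 2) ^ 2 * speed ((p 0 + q 0) / 2) ^ 2 + (p 1 - q 1) ^ 2 := by
  have h2 : √2 ^ 2 = 2 := sq_sqrt (by norm_num)
  rw [EuclideanSpace.dist_eq, sq_sqrt (by positivity), Fin.sum_univ_three, speed_sq]
  have hs := sin_sub_sin (p 0) (q 0)
  have hc := cos_sub_cos (p 0) (q 0)
  have e1 : dist (cyl p 0) (cyl q 0) ^ 2 = (sin (p 0) - sin (q 0)) ^ 2 := by
    rw [Real.dist_eq, sq_abs]; simp [cyl]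
  have e2 : dist (cyl p 1) (cyl q 1) ^ 2
      = ((√2 * (p 1 - q 1) - (cos (p 0) - cos (q 0))) / 2) ^ 2 := by
    rw [Real.dist_eq, sq_abs]; simp [cyl]; ring
  have e3 : dist (cyl p 2) (cyl q 2) ^ 2
      = ((√2 * (p 1 - q 1) + (cos (p 0) - cos (q 0))) / 2) ^ 2 := by
    rw [Real.dist_eq, sq_abs]; simp [cyl]; ring
  rw [e1, e2, e3, hs, hc]
  have := cos_sq' ((p 0 + q 0) / 2)
  linear_combination (2 * sin ((p 0 - q 0) / 2)) ^ 2 * this + (p 1 - q 1) ^ 2 / 2 * h2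

/-- Scaling of the first coordinate. -/
def stretch (c : ℝ) (p : EuclideanSpace ℝ (Fin 2)) : EuclideanSpace ℝ (Fin 2) :=
  !₂[c * p 0, p 1]

theorem dist_stretch_sq (c : ℝ) (p q : EuclideanSpace ℝ (Fin 2)) :
    dist (stretch c p) (stretch c q) ^ 2 = c ^ 2 * (p 0 - q 0) ^ 2 + (p 1 - q 1) ^ 2 := by
  rw [EuclideanSpace.dist_eq, sq_sqrt (by positivity), Fin.sum_univ_two]
  simp [stretch, Real.dist_eq]
  ring

theorem volume_stretch_image {c : ℝ} (hc : 0 ≤ c) (A : Set (EuclideanSpace ℝ (Fin 2))) :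
    volume (stretch c '' A) = ENNReal.ofReal c * volume A := by
  let M : Matrix (Fin 2) (Fin 2) ℝ := !![c, 0; 0, 1]
  have h : stretch c = (Matrix.toEuclideanLin M : _ → _) := by
    funext p
    ext i
    fin_cases i <;> simp [stretch, M, Matrix.toLpLin_apply, dotProduct,
      Fin.sum_univ_two]
  rw [h, Measure.addHaar_image_linearMap]
  have : LinearMap.det (Matrix.toEuclideanLin M) = c := by
    rw [Matrix.toEuclideanLin_eq_toLin_orthonormal, LinearMap.det_toLin]
    simp [M, Matrix.det_fin_two]
  rw [this, abs_of_nonneg hc]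

theorem abs_sin_sq_sub_sin_sq_le (a b : ℝ) : |sin a ^ 2 - sin b ^ 2| ≤ |a - b| := by
  have h : sin a ^ 2 - sin b ^ 2 = sin (a + b) * sin (a - b) := by
    rw [sin_add, sin_sub]
    nlinarith [sin_sq_add_cos_sq a, sin_sq_add_cos_sq b]
  rw [h, abs_mul]
  calc |sin (a + b)| * |sin (a - b)| ≤ 1 * |a - b| :=
        mul_le_mul (abs_sin_le_one _) abs_sin_le_abs (abs_nonneg _) zero_le_one
    _ = _ := one_mul _

/-- `sin²` is 1-Lipschitz, and `speed² ≥ 1/2` converts the absolute error into a relative one. -/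
theorem speed_sq_le {δ a b : ℝ} (h : |a - b| ≤ δ) : speed a ^ 2 ≤ (1 + 2 * δ) * speed b ^ 2 := by
  have h1 := (abs_le.1 ((abs_sin_sq_sub_sin_sq_le a b).trans h))
  have h0 : 0 ≤ δ := (abs_nonneg _).trans h
  rw [speed_sq, speed_sq]
  nlinarith [half_le_speed_sq b, h1.1, h1.2]

theorem le_speed_sq {δ a b : ℝ} (h : |a - b| ≤ δ) : (1 - 2 * δ) * speed a ^ 2 ≤ speed b ^ 2 := by
  have h1 := (abs_le.1 ((abs_sin_sq_sub_sin_sq_le a b).trans h))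
  have h0 : 0 ≤ δ := (abs_nonneg _).trans h
  rw [speed_sq, speed_sq]
  nlinarith [half_le_speed_sq a, h1.1, h1.2]

theorem four_mul_sin_half_sq_le (d : ℝ) : 4 * sin (d / 2) ^ 2 ≤ d ^ 2 := by
  have : sin (d / 2) ^ 2 ≤ (d / 2) ^ 2 := sq_le_sq.2 abs_sin_le_abs
  linarith

theorem le_four_mul_sin_half_sq {δ d : ℝ} (h : |d| ≤ δ) (hδ : δ ≤ 1 / 2) :
    (1 - 2 * δ) * d ^ 2 ≤ 4 * sin (d / 2) ^ 2 := by
  have key : ∀ x : ℝ, 0 ≤ x → x ≤ δ → (1 - 2 * δ) * x ^ 2 ≤ 4 * sin (x / 2) ^ 2 := by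
    intro x hx hxδ
    rcases hx.eq_or_lt with rfl | hx
    · simp
    have h1 := sin_gt_sub_cube (x := x / 2) (by positivity)
    have h2 : (1 - δ) * (x / 2) ≤ sin (x / 2) := by
      refine le_trans ?_ h1.le
      nlinarith [mul_pos hx hx, mul_pos hx (mul_pos hx hx)]
    have h3 : ((1 - δ) * (x / 2)) ^ 2 ≤ sin (x / 2) ^ 2 :=
      pow_le_pow_left₀ (mul_nonneg (by linarith) (by linarith)) h2 2
    nlinarith [mul_pos hx hx, sq_nonneg δ, sq_nonneg (δ * x)]
  have := key |d| (abs_nonneg _) h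
  rw [sq_abs] at this
  rcases abs_choice d with hd | hd <;> rw [hd] at this
  · exact this
  · rwa [neg_div, sin_neg, neg_sq] at this

theorem edist_le_mul_of_sq_le {X Y : Type*} [PseudoMetricSpace X] [PseudoMetricSpace Y]
    {a b : X} {c d : Y} {K : ℝ} (hK : 0 ≤ K) (h : dist a b ^ 2 ≤ K ^ 2 * dist c d ^ 2) :
    edist a b ≤ (K.toNNReal : ℝ≥0∞) * edist c d := by
  have h1 : dist a b ≤ K * dist c d := by
    rw [← mul_pow] at h
    exact le_of_sq_le_sq h (by positivity)
  rw [edist_dist, edist_dist]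
  change _ ≤ ENNReal.ofReal K * _
  rw [← ENNReal.ofReal_mul hK]
  exact ENNReal.ofReal_le_ofReal h1

theorem le_inv_mul_of_sq_le {δ a b : ℝ} (hδ : 0 ≤ δ) (hδ' : δ ≤ 1 / 4) (hb : 0 ≤ b)
    (h : a ^ 2 ≤ (1 + 2 * δ) * b ^ 2) : a ≤ (1 - 2 * δ)⁻¹ * b := by
  have hK : 1 + 2 * δ ≤ (1 - 2 * δ)⁻¹ := by
    rw [le_inv_comm₀ (by linarith) (by linarith), inv_eq_one_div, le_div_iff₀ (by linarith)]
    nlinarith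
  have h1 : a ≤ (1 + 2 * δ) * b := by
    refine le_of_sq_le_sq (h.trans ?_) (by positivity)
    rw [mul_pow]
    nlinarith [sq_nonneg b, mul_nonneg hδ (sq_nonneg b)]
  exact h1.trans (by gcongr)

section Strip

variable {δ τ : ℝ} {A : Set (EuclideanSpace ℝ (Fin 2))}

/-- The mean angle stays within `δ` of `τ`, so its speed may be frozen at `τ`. Together with
`dist_stretch_sq_le` this makes `cyl` nearly isometric to the linear model `stretch (speed τ)`. -/
theorem dist_cyl_sq_le (hδ : 0 ≤ δ) (hδ' : δ ≤ 1 / 4) {p q : EuclideanSpace ℝ (Fin 2)}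
    (hp : p 0 ∈ Ico τ (τ + δ)) (hq : q 0 ∈ Ico τ (τ + δ)) :
    dist (cyl p) (cyl q) ^ 2
      ≤ ((1 - 2 * δ)⁻¹) ^ 2 * dist (stretch (speed τ) p) (stretch (speed τ) q) ^ 2 := by
  have hm : |(p 0 + q 0) / 2 - τ| ≤ δ := by
    rw [abs_le]; constructor <;> linarith [hp.1, hp.2, hq.1, hq.2]
  have hK : 1 + 2 * δ ≤ ((1 - 2 * δ)⁻¹) ^ 2 := by
    rw [← one_div, div_pow, le_div_iff₀ (by nlinarith)]
    nlinarith [mul_nonneg hδ hδ, mul_nonneg hδ (mul_nonneg hδ hδ)]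
  rw [dist_cyl_sq, dist_stretch_sq]
  have h1 := four_mul_sin_half_sq_le (p 0 - q 0)
  have h2 := speed_sq_le hm
  calc _ ≤ (p 0 - q 0) ^ 2 * ((1 + 2 * δ) * speed τ ^ 2) + (p 1 - q 1) ^ 2 := by gcongr
    _ ≤ (1 + 2 * δ) * (speed τ ^ 2 * (p 0 - q 0) ^ 2 + (p 1 - q 1) ^ 2) := by
      nlinarith [mul_nonneg hδ (sq_nonneg (p 1 - q 1))]
    _ ≤ _ := by gcongr

theorem dist_stretch_sq_le (hδ : 0 ≤ δ) (hδ' : δ ≤ 1 / 4) {p q : EuclideanSpace ℝ (Fin 2)}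
    (hp : p 0 ∈ Ico τ (τ + δ)) (hq : q 0 ∈ Ico τ (τ + δ)) :
    dist (stretch (speed τ) p) (stretch (speed τ) q) ^ 2
      ≤ ((1 - 2 * δ)⁻¹) ^ 2 * dist (cyl p) (cyl q) ^ 2 := by
  have hm : |τ - (p 0 + q 0) / 2| ≤ δ := by
    rw [abs_le]; constructor <;> linarith [hp.1, hp.2, hq.1, hq.2]
  have hd : |p 0 - q 0| ≤ δ := by
    rw [abs_le]; constructor <;> linarith [hp.1, hp.2, hq.1, hq.2]
  rw [dist_cyl_sq, dist_stretch_sq, inv_pow, ← div_eq_inv_mul, le_div_iff₀ (by nlinarith)]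
  have h1 := le_four_mul_sin_half_sq hd (by linarith)
  have h2 := le_speed_sq hm
  have hκ : 0 ≤ 1 - 2 * δ := by linarith
  calc _ = ((1 - 2 * δ) * (p 0 - q 0) ^ 2) * ((1 - 2 * δ) * speed τ ^ 2)
        + (1 - 2 * δ) ^ 2 * (p 1 - q 1) ^ 2 := by ring
    _ ≤ (4 * sin ((p 0 - q 0) / 2) ^ 2) * speed ((p 0 + q 0) / 2) ^ 2
        + 1 * (p 1 - q 1) ^ 2 := by
      gcongr
      nlinarith
    _ = _ := by ring

/-- Of the three factors, two are the Lipschitz constant raised to the dimension; the third pays for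
replacing `speed τ` by `speed (p 0)` under the integral. -/
theorem measure_cyl_image_strip (hδ : 0 ≤ δ) (hδ' : δ ≤ 1 / 4) (hA : MeasurableSet A)
    (hAτ : ∀ p ∈ A, p 0 ∈ Ico τ (τ + δ)) :
    euclideanHausdorffMeasure 2 (cyl '' A)
        ≤ ENNReal.ofReal (1 - 2 * δ)⁻¹ ^ 3 * ∫⁻ p in A, ENNReal.ofReal (speed (p 0)) ∧
      ∫⁻ p in A, ENNReal.ofReal (speed (p 0))
        ≤ ENNReal.ofReal (1 - 2 * δ)⁻¹ ^ 3 * euclideanHausdorffMeasure 2 (cyl '' A) := by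
  have hK : 0 ≤ (1 - 2 * δ)⁻¹ := inv_nonneg.2 (by linarith)
  have up := euclideanHausdorffMeasure_image_le_of_edist_le (f := cyl) (g := stretch (speed τ))
    (A := A) 2 fun p hp q hq => edist_le_mul_of_sq_le hK
      (dist_cyl_sq_le hδ hδ' (hAτ p hp) (hAτ q hq))
  have low := euclideanHausdorffMeasure_image_le_of_edist_le (g := cyl) (f := stretch (speed τ))
    (A := A) 2 fun p hp q hq => edist_le_mul_of_sq_le hK
      (dist_stretch_sq_le hδ hδ' (hAτ p hp) (hAτ q hq))
  rw [EuclideanSpace.euclideanHausdorffMeasure_eq_volume,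
    volume_stretch_image (speed_nonneg τ)] at up low
  have hab : ∀ p ∈ A, |p 0 - τ| ≤ δ := fun p hp => by
    rw [abs_le]; constructor <;> linarith [(hAτ p hp).1, (hAτ p hp).2]
  have i1 : ENNReal.ofReal (speed τ) * volume A
      ≤ ENNReal.ofReal (1 - 2 * δ)⁻¹ * ∫⁻ p in A, ENNReal.ofReal (speed (p 0)) := by
    rw [← lintegral_const_mul' _ _ ENNReal.ofReal_ne_top, ← setLIntegral_const]
    refine setLIntegral_mono' hA fun p hp => ?_
    rw [← ENNReal.ofReal_mul hK]
    refine ENNReal.ofReal_le_ofReal (le_inv_mul_of_sq_le hδ hδ' (speed_nonneg _) ?_)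
    exact speed_sq_le (by rw [abs_sub_comm]; exact hab p hp)
  have i2 : ∫⁻ p in A, ENNReal.ofReal (speed (p 0))
      ≤ ENNReal.ofReal (1 - 2 * δ)⁻¹ * (ENNReal.ofReal (speed τ) * volume A) := by
    rw [← mul_assoc, ← ENNReal.ofReal_mul hK, ← setLIntegral_const]
    refine setLIntegral_mono' hA fun p hp => ?_
    refine ENNReal.ofReal_le_ofReal (le_inv_mul_of_sq_le hδ hδ' (speed_nonneg _) ?_)
    exact speed_sq_le (hab p hp)
  change _ ≤ ENNReal.ofReal (1 - 2 * δ)⁻¹ ^ 2 * _ at up low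
  constructor
  · refine up.trans ?_
    rw [pow_succ (_ : ℝ≥0∞) 2, mul_assoc]
    gcongr
  · refine i2.trans ?_
    rw [pow_succ' (_ : ℝ≥0∞) 2, mul_assoc]
    gcongr

end Strip

/-- The area formula for the cylinder. -/
theorem measure_cyl_image {A : Set (EuclideanSpace ℝ (Fin 2))} (hA : MeasurableSet A)
    (hinj : InjOn cyl A) :
    euclideanHausdorffMeasure 2 (cyl '' A) = ∫⁻ p in A, ENNReal.ofReal (speed (p 0)) := by
  set H := euclideanHausdorffMeasure 2 (cyl '' A)
  set I := ∫⁻ p in A, ENNReal.ofReal (speed (p 0))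
  have main : ∀ δ : ℝ, 0 < δ → δ ≤ 1 / 4 →
      H ≤ ENNReal.ofReal (1 - 2 * δ)⁻¹ ^ 3 * I ∧ I ≤ ENNReal.ofReal (1 - 2 * δ)⁻¹ ^ 3 * H := by
    intro δ hδ hδ'
    let B : ℤ → Set (EuclideanSpace ℝ (Fin 2)) := fun n =>
      A ∩ {p | p 0 ∈ Ico (n • δ) ((n + 1) • δ)}
    have hBm : ∀ n, MeasurableSet (B n) := fun n =>
      hA.inter (measurableSet_Ico.preimage (by fun_prop))
    have hBd : Pairwise (Function.onFun Disjoint B) := fun m n hmn =>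
      ((pairwise_disjoint_Ico_zsmul δ hmn).preimage
        (fun p : EuclideanSpace ℝ (Fin 2) => p 0)).mono inter_subset_right inter_subset_right
    have hBU : ⋃ n, B n = A := by
      rw [← inter_iUnion, inter_eq_left]
      intro p _
      have : p 0 ∈ ⋃ n : ℤ, Ico (n • δ) ((n + 1) • δ) := by
        rw [iUnion_Ico_zsmul hδ]; trivial
      simpa using this
    -- Injectivity makes the images of the strips disjoint, and also measurable, as injective
    -- continuous images of Borel sets.
    have hH : H = ∑' n, euclideanHausdorffMeasure 2 (cyl '' B n) := by
      rw [← measure_iUnion, ← image_iUnion, hBU]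
      · intro m n hmn
        exact (hBd hmn).image hinj inter_subset_left inter_subset_left
      · exact fun n => (hBm n).image_of_continuousOn_injOn continuous_cyl.continuousOn
          (hinj.mono inter_subset_left)
    have hI : I = ∑' n, ∫⁻ p in B n, ENNReal.ofReal (speed (p 0)) := by
      rw [← lintegral_iUnion hBm hBd, hBU]
    have hs := fun n => measure_cyl_image_strip (τ := n • δ) hδ.le hδ' (hBm n) (by
      intro p hp
      have := hp.2
      rwa [mem_ofPred_eq, add_smul, one_smul] at this)
    rw [hH, hI, ← ENNReal.tsum_mul_left, ← ENNReal.tsum_mul_left]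
    exact ⟨ENNReal.tsum_le_tsum fun n => (hs n).1, ENNReal.tsum_le_tsum fun n => (hs n).2⟩
  have hlim : ∀ c : ℝ≥0∞, Tendsto (fun δ : ℝ => ENNReal.ofReal (1 - 2 * δ)⁻¹ ^ 3 * c)
      (𝓝[>] 0) (𝓝 c) := by
    intro c
    have h1 : Tendsto (fun δ : ℝ => (1 - 2 * δ)⁻¹) (𝓝[>] 0) (𝓝 1) := by
      have : ContinuousAt (fun δ : ℝ => (1 - 2 * δ)⁻¹) 0 :=
        ContinuousAt.inv₀ (by fun_prop) (by norm_num)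
      simpa using this.tendsto.mono_left nhdsWithin_le_nhds
    have h2 := ((ENNReal.continuous_pow 3).tendsto _).comp
      ((ENNReal.continuous_ofReal.tendsto _).comp h1)
    have h3 := ENNReal.Tendsto.mul_const (b := c) h2 (Or.inl (by simp))
    simpa using h3
  have hev : ∀ᶠ δ : ℝ in 𝓝[>] 0, 0 < δ ∧ δ ≤ 1 / 4 :=
    eventually_mem_nhdsWithin.and
      (nhdsWithin_le_nhds (Iic_mem_nhds (by norm_num)))
  exact le_antisymm (ge_of_tendsto (hlim I) (hev.mono fun δ h => (main δ h.1 h.2).1))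
    (ge_of_tendsto (hlim H) (hev.mono fun δ h => (main δ h.1 h.2).2))

/-! ### The body, its boundary, and its area -/

/-- The convex hull of the two disks, as a cylinder cut by two half-spaces. -/
theorem body_eq :
    body = {p | p 0 ^ 2 + (p 2 - p 1 + 1) ^ 2 ≤ 1 ∧ -1 ≤ p 2 ∧ p 1 ≤ 1} := by
  apply Subset.antisymm
  · refine convexHull_min ?_ ?_
    · rintro p (⟨h, hz⟩ | ⟨h, hy⟩)
      · refine ⟨?_, hz.ge, ?_⟩
        · rw [hz]; linarith
        · nlinarith [sq_nonneg (p 0)]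
      · refine ⟨?_, ?_, hy.le⟩
        · rw [hy]; linarith
        · nlinarith [sq_nonneg (p 0)]
    · intro p hp q hq a b ha hb hab
      obtain ⟨h1, h2, h3⟩ := hp
      obtain ⟨g1, g2, g3⟩ := hq
      refine ⟨?_, ?_, ?_⟩
      · simp only [PiLp.add_apply, PiLp.smul_apply, smul_eq_mul]
        obtain rfl : a = 1 - b := by linarith
        nlinarith [mul_nonneg ha hb, mul_nonneg (mul_nonneg ha hb) (sq_nonneg (p 0 - q 0)),
          mul_nonneg (mul_nonneg ha hb) (sq_nonneg ((p 2 - p 1 + 1) - (q 2 - q 1 + 1))),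
          mul_le_mul_of_nonneg_left h1 ha, mul_le_mul_of_nonneg_left g1 hb]
      · simp only [PiLp.add_apply, PiLp.smul_apply, smul_eq_mul]
        nlinarith
      · simp only [PiLp.add_apply, PiLp.smul_apply, smul_eq_mul]
        nlinarith
  · rintro p ⟨h1, h2, h3⟩
    have hsub := subset_convexHull ℝ (diskXY ∪ diskXZ)
    -- Slide `p` along the ruling direction `(0, 1, 1)` to the planes `z = -1` and `y = 1`; `p` lies
    -- on the segment between the two points obtained.
    have ha : !₂[p 0, p 1 - p 2 - 1, -1] ∈ diskXY :=
      ⟨by simp; linarith [h1], by simp⟩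
    have hb : !₂[p 0, 1, p 2 - p 1 + 1] ∈ diskXZ :=
      ⟨by simp; linarith [h1], by simp⟩
    have hs : 0 ≤ (p 2 + 1) + (1 - p 1) := by linarith
    -- The weights are undefined only when `p` lies on both planes, and then `p` is already in a
    -- disk.
    rcases hs.eq_or_lt with hs | hs
    · refine hsub (Or.inl ⟨?_, by linarith⟩)
      have e1 : p 2 = -1 := by linarith
      have e2 : p 1 = 1 := by linarith
      rw [e1, e2] at h1
      rw [e2]; linarith
    · have hw := (convex_convexHull ℝ (diskXY ∪ diskXZ)) (hsub (Or.inl ha)) (hsub (Or.inr hb))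
        (a := (1 - p 1) / ((p 2 + 1) + (1 - p 1))) (b := (p 2 + 1) / ((p 2 + 1) + (1 - p 1)))
        (div_nonneg (by linarith) hs.le) (div_nonneg (by linarith) hs.le)
        (by field_simp; ring)
      rw [body]
      convert hw using 1
      refine PiLp.ext fun i => ?_
      fin_cases i
      · simp; field_simp; ring
      · simp; field_simp; ring
      · simp; field_simp; ring

theorem abs_le_one_of_sq_add_sq_le_one {a b : ℝ} (h : a ^ 2 + b ^ 2 ≤ 1) : |a| ≤ 1 := by
  rw [← sq_le_one_iff_abs_le_one]
  nlinarith [sq_nonneg b]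

/-- The graphs of `phi` and `psi` are the two branches `z - y + 1 = ±√(1 - x²)`; on each, the lower
bound on `y` is exactly `z ≥ -1`. -/
theorem mem_curved_iff (p : EuclideanSpace ℝ (Fin 3)) :
    p ∈ curved ↔ p 0 ^ 2 + (p 2 - p 1 + 1) ^ 2 = 1 ∧ -1 ≤ p 2 ∧ p 1 ≤ 1 := by
  constructor
  · rintro (⟨⟨hx, hy, hxy⟩, hz⟩ | ⟨⟨hx, hy, hxy⟩, hz⟩)
    all_goals
      dsimp only at hx hy hxy
      have hsq : √(1 - p 0 ^ 2) ^ 2 = 1 - p 0 ^ 2 :=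
        sq_sqrt (by linarith [(sq_le_one_iff_abs_le_one _).2 hx])
      refine ⟨?_, ?_, (abs_le.1 hy).2⟩
    · rw [hz, phi]; linarith [hsq]
    · rw [hz, phi]; linarith
    · rw [hz, psi]; linarith [hsq]
    · rw [hz, psi]; linarith
  · rintro ⟨h1, h2, h3⟩
    have hx := abs_le_one_of_sq_add_sq_le_one h1.le
    have hs : √(1 - p 0 ^ 2) = |p 2 - p 1 + 1| := by
      rw [← sqrt_sq_eq_abs]; congr 1; linarith
    have hw := abs_le.1 (abs_le_one_of_sq_add_sq_le_one (a := p 2 - p 1 + 1) (b := p 0)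
      (by linarith))
    have hy : |p 1| ≤ 1 := abs_le.2 ⟨by linarith, h3⟩
    rcases le_total 0 (p 2 - p 1 + 1) with h | h
    · rw [abs_of_nonneg h] at hs
      refine Or.inl ⟨⟨hx, hy, ?_⟩, ?_⟩
      · dsimp only; rw [hs]; linarith
      · rw [phi, hs]; ring
    · rw [abs_of_nonpos h] at hs
      refine Or.inr ⟨⟨hx, hy, ?_⟩, ?_⟩
      · dsimp only; rw [hs]; linarith
      · rw [psi, hs]; ring

theorem isClosed_body : IsClosed body := by
  rw [body_eq]
  simp only [ofPred_and]
  refine IsClosed.inter (isClosed_le ?_ ?_) (IsClosed.inter (isClosed_le ?_ ?_) (isClosed_le ?_ ?_))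
  all_goals fun_prop

theorem isClosed_curved : IsClosed curved := by
  have : curved = {p | p 0 ^ 2 + (p 2 - p 1 + 1) ^ 2 = 1 ∧ -1 ≤ p 2 ∧ p 1 ≤ 1} :=
    ext mem_curved_iff
  rw [this]
  simp only [ofPred_and]
  refine IsClosed.inter (isClosed_eq ?_ ?_) (IsClosed.inter (isClosed_le ?_ ?_) (isClosed_le ?_ ?_))
  all_goals fun_prop

theorem isClosed_diskXZ : IsClosed diskXZ := by
  rw [diskXZ, ofPred_and]
  exact (isClosed_le (by fun_prop) (by fun_prop)).inter (isClosed_eq (by fun_prop) (by fun_prop))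

/-- An interior point can be moved a little in any direction. -/
theorem exists_pos_add_smul_mem {E : Type*} [NormedAddCommGroup E] [NormedSpace ℝ E] {K : Set E}
    {p : E} (hp : p ∈ interior K) (v : E) : ∃ τ : ℝ, 0 < τ ∧ p + τ • v ∈ K := by
  have hc : Continuous fun τ : ℝ => p + τ • v := by fun_prop
  have h0 : ∀ᶠ τ : ℝ in 𝓝 0, p + τ • v ∈ K :=
    hc.continuousAt.eventually_mem (by simpa using mem_interior_iff_mem_nhds.1 hp)
  have h1 : ∀ᶠ τ : ℝ in 𝓝[>] 0, 0 < τ ∧ p + τ • v ∈ K :=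
    eventually_mem_nhdsWithin.and (nhdsWithin_le_nhds h0)
  exact h1.exists

theorem frontier_body : frontier body = diskXY ∪ diskXZ ∪ curved := by
  rw [isClosed_body.frontier_eq]
  ext p
  constructor
  · rintro ⟨hp, hpi⟩
    rw [body_eq] at hp
    obtain ⟨h1, h2, h3⟩ := hp
    by_contra hne
    simp only [mem_union, not_or] at hne
    obtain ⟨⟨n1, n2⟩, n3⟩ := hne
    apply hpi
    have l2 : -1 < p 2 := h2.lt_of_ne fun h => n1 ⟨by rw [← h] at h1; linarith, h.symm⟩
    have l3 : p 1 < 1 := h3.lt_of_ne fun h => n2 ⟨by rw [h] at h1; linarith, h⟩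
    have l1 : p 0 ^ 2 + (p 2 - p 1 + 1) ^ 2 < 1 := h1.lt_of_ne fun h =>
      n3 ((mem_curved_iff p).2 ⟨h, h2, h3⟩)
    have hopen : IsOpen {p : EuclideanSpace ℝ (Fin 3) |
        p 0 ^ 2 + (p 2 - p 1 + 1) ^ 2 < 1 ∧ -1 < p 2 ∧ p 1 < 1} := by
      simp only [ofPred_and]
      refine IsOpen.inter (isOpen_lt ?_ ?_) (IsOpen.inter (isOpen_lt ?_ ?_) (isOpen_lt ?_ ?_))
      all_goals fun_prop
    refine interior_maximal ?_ hopen ⟨l1, l2, l3⟩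
    rw [body_eq]
    exact fun q hq => ⟨hq.1.le, hq.2.1.le, hq.2.2.le⟩
  · intro hp
    have hmem : p ∈ body := by
      rcases hp with hp | hp
      · exact subset_convexHull ℝ _ hp
      · rw [body_eq]
        have := (mem_curved_iff p).1 hp
        exact ⟨this.1.le, this.2⟩
    refine ⟨hmem, fun hi => ?_⟩
    rcases hp with (⟨_, hz⟩ | ⟨_, hy⟩) | hp
    · obtain ⟨τ, hτ, h⟩ := exists_pos_add_smul_mem hi !₂[0, 0, -1]
      rw [body_eq] at h
      have := h.2.1
      simp [hz] at this
      linarith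
    · obtain ⟨τ, hτ, h⟩ := exists_pos_add_smul_mem hi !₂[0, 1, 0]
      rw [body_eq] at h
      have := h.2.2
      simp [hy] at this
      linarith
    · have hp := ((mem_curved_iff p).1 hp).1
      -- This direction scales both cross-section coordinates `x` and `z - y + 1` by `1 + τ`,
      -- leaving the cylinder.
      obtain ⟨τ, hτ, h⟩ := exists_pos_add_smul_mem hi !₂[p 0, 0, p 2 - p 1 + 1]
      rw [body_eq] at h
      have h := h.1
      have e : (p 0 + τ * p 0) ^ 2 + (p 2 + τ * (p 2 - p 1 + 1) - p 1 + 1) ^ 2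
          = (1 + τ) ^ 2 * (p 0 ^ 2 + (p 2 - p 1 + 1) ^ 2) := by ring
      simp only [PiLp.add_apply, PiLp.smul_apply, smul_eq_mul, Matrix.cons_val_zero,
        Matrix.cons_val_one, Matrix.cons_val, mul_zero, add_zero] at h
      rw [e, hp] at h
      nlinarith

/-- The parameter region of the curved portion on the cylinder. -/
def cylRegion : Set (EuclideanSpace ℝ (Fin 2)) :=
  {p | p 0 ∈ Ioc (-π) π ∧ p 1 ∈ Icc (-((1 + cos (p 0)) / √2)) ((1 + cos (p 0)) / √2)}

theorem eq_of_cos_eq_of_sin_eq {s t : ℝ} (hs : s ∈ Ioc (-π) π) (ht : t ∈ Ioc (-π) π)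
    (hc : cos s = cos t) (hsin : sin s = sin t) : s = t := by
  have h1 := Complex.arg_mul_cos_add_sin_mul_I one_pos hs
  have h2 := Complex.arg_mul_cos_add_sin_mul_I one_pos ht
  rw [← h1, ← h2]
  simp only [← Complex.ofReal_cos, ← Complex.ofReal_sin, hc, hsin]

theorem injOn_cyl : InjOn cyl cylRegion := by
  intro p hp q hq h
  have h0 : sin (p 0) = sin (q 0) := by simpa [cyl] using congrArg (fun r => r 0) h
  have h1 : (√2 * p 1 - cos (p 0) + 1) / 2 = (√2 * q 1 - cos (q 0) + 1) / 2 := by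
    simpa [cyl] using congrArg (fun r => r 1) h
  have h2 : (√2 * p 1 + cos (p 0) - 1) / 2 = (√2 * q 1 + cos (q 0) - 1) / 2 := by
    simpa [cyl] using congrArg (fun r => r 2) h
  have e0 := eq_of_cos_eq_of_sin_eq hp.1 hq.1 (by linarith) h0
  have e1 : p 1 = q 1 := by
    have : √2 * p 1 = √2 * q 1 := by linarith
    exact mul_left_cancel₀ (by positivity) this
  ext i
  fin_cases i
  · exact e0
  · exact e1

theorem exists_sin_cos {a b : ℝ} (h : a ^ 2 + b ^ 2 = 1) :
    ∃ t ∈ Ioc (-π) π, sin t = a ∧ cos t = b := by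
  have hn : ‖(⟨b, a⟩ : ℂ)‖ = 1 := by
    rw [Complex.norm_def, Complex.normSq_mk, ← sqrt_one]; congr 1; linarith
  have h0 : (⟨b, a⟩ : ℂ) ≠ 0 := by
    intro h0; rw [h0] at hn; simp at hn
  refine ⟨Complex.arg ⟨b, a⟩, Complex.arg_mem_Ioc _, ?_, ?_⟩
  · rw [Complex.sin_arg, hn, div_one]
  · rw [Complex.cos_arg h0, hn, div_one]

/-- On the ruling at angle `t`, the conditions `z ≥ -1` and `y ≤ 1` read `-(1 + cos t) ≤ √2 s ≤ 1 +
cos t`. -/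
theorem cyl_image_cylRegion : cyl '' cylRegion = curved := by
  have h2 : (0 : ℝ) < √2 := by positivity
  ext p
  rw [mem_curved_iff]
  constructor
  · rintro ⟨q, ⟨_, hq⟩, rfl⟩
    have hl := mul_le_mul_of_nonneg_left hq.1 h2.le
    have hr := mul_le_mul_of_nonneg_left hq.2 h2.le
    rw [mul_neg, mul_div_cancel₀ _ h2.ne'] at hl
    rw [mul_div_cancel₀ _ h2.ne'] at hr
    refine ⟨?_, ?_, ?_⟩
    · simp [cyl]
      linarith [sin_sq_add_cos_sq (q 0)]
    · simp [cyl]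
      linarith
    · simp [cyl]
      linarith
  · rintro ⟨h1, hz, hy⟩
    obtain ⟨t, ht, hs, hc⟩ := exists_sin_cos h1
    refine ⟨!₂[t, (p 1 + p 2) / √2], ⟨by simpa using ht, ?_⟩, ?_⟩
    · simp [hc]
      rw [← neg_div, div_le_div_iff_of_pos_right h2, div_le_div_iff_of_pos_right h2]
      constructor <;> linarith
    · ext i
      fin_cases i
      · simp [cyl, hs]
      · simp [cyl, hc, mul_div_cancel₀ _ h2.ne']; ring
      · simp [cyl, hc, mul_div_cancel₀ _ h2.ne']; ring

theorem measurableSet_cylRegion : MeasurableSet cylRegion := by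
  simp only [cylRegion, mem_Icc, ofPred_and]
  refine MeasurableSet.inter (measurableSet_Ioc.preimage (by fun_prop))
    (MeasurableSet.inter (measurableSet_le ?_ ?_) (measurableSet_le ?_ ?_))
  all_goals fun_prop

theorem volumePreserving_coords :
    MeasurePreserving (fun p : EuclideanSpace ℝ (Fin 2) => (p 0, p 1)) volume volume :=
  (volume_preserving_finTwoArrow ℝ).comp (PiLp.volume_preserving_ofLp (Fin 2))

theorem area_curved :
    euclideanHausdorffMeasure 2 curved
      = ENNReal.ofReal (∫ t in (-π)..π, √2 * (1 + cos t) * speed t) := by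
  have h2 : (0 : ℝ) < √2 := by positivity
  rw [← cyl_image_cylRegion, measure_cyl_image measurableSet_cylRegion injOn_cyl]
  let R : Set (ℝ × ℝ) := {q | q.1 ∈ Ioc (-π) π ∧
    q.2 ∈ Icc (-((1 + cos q.1) / √2)) ((1 + cos q.1) / √2)}
  have hR : MeasurableSet R := by
    simp only [R, mem_Icc, ofPred_and]
    refine MeasurableSet.inter (measurableSet_Ioc.preimage (by fun_prop))
      (MeasurableSet.inter (measurableSet_le ?_ ?_) (measurableSet_le ?_ ?_))
    all_goals fun_prop
  have hm : Measurable fun q : ℝ × ℝ => ENNReal.ofReal (speed q.1) :=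
    ENNReal.measurable_ofReal.comp (continuous_speed.measurable.comp measurable_fst)
  have e1 : ∫⁻ p in cylRegion, ENNReal.ofReal (speed (p 0))
      = ∫⁻ q in R, ENNReal.ofReal (speed q.1) :=
    volumePreserving_coords.setLIntegral_comp_preimage hR hm
  rw [e1, ← lintegral_indicator hR, Measure.volume_eq_prod, lintegral_prod _
    (hm.indicator hR).aemeasurable]
  have e2 : ∀ t : ℝ, ∫⁻ s, R.indicator (fun q => ENNReal.ofReal (speed q.1)) (t, s)
      = (Ioc (-π) π).indicator (fun t => ENNReal.ofReal (√2 * (1 + cos t) * speed t)) t := by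
    intro t
    by_cases ht : t ∈ Ioc (-π) π
    · have : ∀ s, R.indicator (fun q => ENNReal.ofReal (speed q.1)) (t, s)
          = (Icc (-((1 + cos t) / √2)) ((1 + cos t) / √2)).indicator
            (fun _ => ENNReal.ofReal (speed t)) s := by
        intro s
        by_cases hs : s ∈ Icc (-((1 + cos t) / √2)) ((1 + cos t) / √2)
        · rw [indicator_of_mem hs, indicator_of_mem (show (t, s) ∈ R from ⟨ht, hs⟩)]
        · rw [indicator_of_notMem hs, indicator_of_notMem fun h : (t, s) ∈ R => hs h.2]
      simp_rw [this]
      rw [lintegral_indicator measurableSet_Icc, setLIntegral_const, indicator_of_mem ht,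
        Real.volume_Icc, ← ENNReal.ofReal_mul (speed_nonneg t)]
      congr 1
      have : √2 * √2 = 2 := mul_self_sqrt (by norm_num)
      field_simp
      linear_combination -(speed t * (1 + cos t)) * this
    · have : ∀ s, R.indicator (fun q => ENNReal.ofReal (speed q.1)) (t, s) = 0 := fun s =>
        indicator_of_notMem (fun h => ht h.1) _
      simp [this, indicator_of_notMem ht]
  simp_rw [e2]
  rw [lintegral_indicator measurableSet_Ioc, intervalIntegral.integral_of_le (by linarith [pi_pos]),
    ofReal_integral_eq_lintegral_ofReal]
  · have : Continuous fun t => √2 * (1 + cos t) * speed t := by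
      have := continuous_speed
      fun_prop
    exact this.integrableOn_Ioc
  · refine ae_of_all _ fun t => ?_
    have := neg_one_le_cos t
    exact mul_nonneg (mul_nonneg h2.le (by linarith)) (speed_nonneg t)

/-- The plane `z = -1` as an isometric copy of the Euclidean plane. -/
def planeXY (q : EuclideanSpace ℝ (Fin 2)) : EuclideanSpace ℝ (Fin 3) := !₂[q 0, q 1, -1]

/-- The plane `y = 1` as an isometric copy of the Euclidean plane. -/
def planeXZ (q : EuclideanSpace ℝ (Fin 2)) : EuclideanSpace ℝ (Fin 3) := !₂[q 0, 1, q 1]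

theorem isometry_planeXY : Isometry planeXY :=
  Isometry.of_dist_eq fun p q => by
    rw [EuclideanSpace.dist_eq, EuclideanSpace.dist_eq, Fin.sum_univ_two, Fin.sum_univ_three]
    simp [planeXY]

theorem isometry_planeXZ : Isometry planeXZ :=
  Isometry.of_dist_eq fun p q => by
    rw [EuclideanSpace.dist_eq, EuclideanSpace.dist_eq, Fin.sum_univ_two, Fin.sum_univ_three]
    simp [planeXZ]

theorem norm_sq_fin_two (q : EuclideanSpace ℝ (Fin 2)) : ‖q‖ ^ 2 = q 0 ^ 2 + q 1 ^ 2 := by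
  rw [EuclideanSpace.norm_sq_eq, Fin.sum_univ_two]; simp

theorem planeXY_image : planeXY '' Metric.closedBall 0 1 = diskXY := by
  ext p
  constructor
  · rintro ⟨q, hq, rfl⟩
    rw [mem_closedBall_zero_iff, ← sq_le_one_iff₀ (norm_nonneg q), norm_sq_fin_two] at hq
    exact ⟨by simpa [planeXY] using hq, by simp [planeXY]⟩
  · rintro ⟨h, hz⟩
    refine ⟨!₂[p 0, p 1], ?_, ?_⟩
    · rw [mem_closedBall_zero_iff, ← sq_le_one_iff₀ (norm_nonneg _), norm_sq_fin_two]
      simpa using h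
    · ext i; fin_cases i <;> simp [planeXY, hz]

theorem planeXZ_image : planeXZ '' Metric.closedBall 0 1 = diskXZ := by
  ext p
  constructor
  · rintro ⟨q, hq, rfl⟩
    rw [mem_closedBall_zero_iff, ← sq_le_one_iff₀ (norm_nonneg q), norm_sq_fin_two] at hq
    exact ⟨by simpa [planeXZ] using hq, by simp [planeXZ]⟩
  · rintro ⟨h, hz⟩
    refine ⟨!₂[p 0, p 2], ?_, ?_⟩
    · rw [mem_closedBall_zero_iff, ← sq_le_one_iff₀ (norm_nonneg _), norm_sq_fin_two]
      simpa using h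
    · ext i; fin_cases i <;> simp [planeXZ, hz]

theorem measure_image_isometry {f : EuclideanSpace ℝ (Fin 2) → EuclideanSpace ℝ (Fin 3)}
    (hf : Isometry f) (A : Set (EuclideanSpace ℝ (Fin 2))) :
    euclideanHausdorffMeasure 2 (f '' A) = volume A := by
  rw [hf.euclideanHausdorffMeasure_image, EuclideanSpace.euclideanHausdorffMeasure_eq_volume]

theorem volume_unit_closedBall :
    volume (Metric.closedBall (0 : EuclideanSpace ℝ (Fin 2)) 1) = ENNReal.ofReal π := by
  rw [EuclideanSpace.volume_closedBall_fin_two]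
  simp

theorem area_diskXY : euclideanHausdorffMeasure 2 diskXY = ENNReal.ofReal π := by
  rw [← planeXY_image, measure_image_isometry isometry_planeXY, volume_unit_closedBall]

theorem area_diskXZ : euclideanHausdorffMeasure 2 diskXZ = ENNReal.ofReal π := by
  rw [← planeXZ_image, measure_image_isometry isometry_planeXZ, volume_unit_closedBall]

theorem measure_image_sphere {f : EuclideanSpace ℝ (Fin 2) → EuclideanSpace ℝ (Fin 3)}
    (hf : Isometry f) : euclideanHausdorffMeasure 2 (f '' Metric.sphere 0 1) = 0 := by
  rw [measure_image_isometry hf]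
  exact Measure.addHaar_sphere _ _ _

/-- The remaining pieces meet this disk only along its rim, an isometric image of a circle and hence
null. -/
theorem diskXY_inter_subset :
    diskXY ∩ (diskXZ ∪ curved) ⊆ planeXY '' Metric.sphere 0 1 := by
  rintro p ⟨⟨h, hz⟩, hp⟩
  have h1 : p 0 ^ 2 + p 1 ^ 2 = 1 := by
    rcases hp with ⟨h', hy⟩ | hp
    · rw [hy] at h ⊢
      nlinarith [sq_nonneg (p 0)]
    · have := ((mem_curved_iff p).1 hp).1
      rw [hz] at this
      linarith
  refine ⟨!₂[p 0, p 1], ?_, ?_⟩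
  · rw [mem_sphere_zero_iff_norm, ← pow_eq_one_iff_of_nonneg (norm_nonneg _) two_ne_zero, norm_sq_fin_two]
    simpa using h1
  · ext i; fin_cases i <;> simp [planeXY, hz]

theorem diskXZ_inter_subset : diskXZ ∩ curved ⊆ planeXZ '' Metric.sphere 0 1 := by
  rintro p ⟨⟨h, hy⟩, hp⟩
  have h1 : p 0 ^ 2 + p 2 ^ 2 = 1 := by
    have := ((mem_curved_iff p).1 hp).1
    rw [hy] at this
    linarith
  refine ⟨!₂[p 0, p 2], ?_, ?_⟩
  · rw [mem_sphere_zero_iff_norm, ← pow_eq_one_iff_of_nonneg (norm_nonneg _) two_ne_zero, norm_sq_fin_two]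
    simpa using h1
  · ext i; fin_cases i <;> simp [planeXZ, hy]

theorem surfaceArea_body : surfaceArea body
    = ENNReal.ofReal (2 * π + ∫ t in (-π)..π, √2 * (1 + cos t) * speed t) := by
  have d1 : AEDisjoint (euclideanHausdorffMeasure 2) diskXY (diskXZ ∪ curved) :=
    measure_mono_null diskXY_inter_subset (measure_image_sphere isometry_planeXY)
  have d2 : AEDisjoint (euclideanHausdorffMeasure 2) diskXZ curved :=
    measure_mono_null diskXZ_inter_subset (measure_image_sphere isometry_planeXZ)
  have hc := isClosed_curved.measurableSet
  have hI : 0 ≤ ∫ t in (-π)..π, √2 * (1 + cos t) * speed t := by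
    refine intervalIntegral.integral_nonneg (by linarith [pi_pos]) fun t _ => ?_
    have := neg_one_le_cos t
    exact mul_nonneg (mul_nonneg (sqrt_nonneg 2) (by linarith)) (speed_nonneg t)
  rw [surfaceArea, frontier_body, union_assoc,
    measure_union₀ (isClosed_diskXZ.measurableSet.union hc).nullMeasurableSet d1,
    measure_union₀ hc.nullMeasurableSet d2, area_diskXY, area_diskXZ, area_curved,
    ← ENNReal.ofReal_add pi_pos.le hI, ← ENNReal.ofReal_add pi_pos.le (by positivity)]
  congr 1
  ring

/-! ### The substitution `x = sin t` -/

theorem sin_image_Ioo : sin '' Ioo (-(π / 2)) (π / 2) = Ioo (-1) 1 := by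
  refine Subset.antisymm (image_subset_iff.2 mapsTo_sin_Ioo) fun x hx => ?_
  exact ⟨arcsin x, ⟨neg_pi_div_two_lt_arcsin.2 hx.1, arcsin_lt_pi_div_two.2 hx.2⟩,
    sin_arcsin hx.1.le hx.2.le⟩

theorem injOn_sin_Ioo : InjOn sin (Ioo (-(π / 2)) (π / 2)) :=
  injOn_sin.mono Ioo_subset_Icc_self

/-- Injective change of variables needs no integrability of `g`. The open interval makes the
derivative `cos` positive. -/
theorem integral_eq_integral_cos_mul_comp_sin (g : ℝ → ℝ) :
    ∫ x in (-1 : ℝ)..1, g x = ∫ t in (-(π / 2))..(π / 2), cos t * g (sin t) := by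
  rw [intervalIntegral.integral_of_le (by norm_num),
    intervalIntegral.integral_of_le (by linarith [pi_pos]), integral_Ioc_eq_integral_Ioo,
    integral_Ioc_eq_integral_Ioo, ← sin_image_Ioo,
    integral_image_eq_integral_abs_deriv_smul measurableSet_Ioo
      (fun x _ => (hasDerivAt_sin x).hasDerivWithinAt) injOn_sin_Ioo]
  refine setIntegral_congr_fun measurableSet_Ioo fun t ht => ?_
  simp only [smul_eq_mul]
  rw [abs_of_pos (cos_pos_of_mem_Ioo ht)]

/-- The area elements may blow up at `±1`; the Jacobian `cos t` removes the singularity. -/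
theorem integrableOn_of_cos_mul_comp_sin {g h : ℝ → ℝ} (hh : Continuous h)
    (hg : ∀ t ∈ Ioo (-(π / 2)) (π / 2), cos t * g (sin t) = h t) : IntegrableOn g (Ioo (-1) 1) := by
  rw [← sin_image_Ioo, integrableOn_image_iff_integrableOn_abs_deriv_smul measurableSet_Ioo
      (fun x _ => (hasDerivAt_sin x).hasDerivWithinAt) injOn_sin_Ioo]
  refine (hh.integrableOn_Icc.mono_set Ioo_subset_Icc_self).congr_fun (fun t ht => ?_)
    measurableSet_Ioo
  rw [← hg t ht, abs_of_pos (cos_pos_of_mem_Ioo ht), smul_eq_mul]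

theorem integral_congr_Ioo {a b : ℝ} (hab : a ≤ b) {f g : ℝ → ℝ} (h : ∀ x ∈ Ioo a b, f x = g x) :
    ∫ x in a..b, f x = ∫ x in a..b, g x := by
  rw [intervalIntegral.integral_of_le hab, intervalIntegral.integral_of_le hab,
    integral_Ioc_eq_integral_Ioo, integral_Ioc_eq_integral_Ioo]
  exact setIntegral_congr_fun measurableSet_Ioo h

/-- A function of the first coordinate is integrable over a rectangle when it is so over a side. -/
theorem integrableOn_prod_of_fst {f : ℝ × ℝ → ℝ} {g : ℝ → ℝ} {a b c d : ℝ}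
    (hg : IntegrableOn g (Ioo a b)) (hf : ∀ q ∈ Ioo a b ×ˢ Icc c d, f q = g q.1) :
    IntegrableOn f (Icc a b ×ˢ Icc c d) := by
  have h1 : IntegrableOn (fun q : ℝ × ℝ => g q.1) (Ioo a b ×ˢ Icc c d) := by
    rw [IntegrableOn, Measure.volume_eq_prod, ← Measure.prod_restrict]
    exact Integrable.comp_fst hg _
  have h2 : IntegrableOn f (Ioo a b ×ˢ Icc c d) :=
    h1.congr_fun (fun q hq => (hf q hq).symm) (measurableSet_Ioo.prod measurableSet_Icc)
  exact h2.congr_set_ae (Measure.set_prod_ae_eq Ioo_ae_eq_Icc.symm (ae_eq_refl _))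

theorem integrableOn_prod_of_snd {f : ℝ × ℝ → ℝ} {g : ℝ → ℝ} {a b c d : ℝ}
    (hg : IntegrableOn g (Ioo c d)) (hf : ∀ q ∈ Icc a b ×ˢ Ioo c d, f q = g q.2) :
    IntegrableOn f (Icc a b ×ˢ Icc c d) := by
  have h1 : IntegrableOn (fun q : ℝ × ℝ => g q.2) (Icc a b ×ˢ Ioo c d) := by
    rw [IntegrableOn, Measure.volume_eq_prod, ← Measure.prod_restrict]
    exact Integrable.comp_snd hg _
  have h2 : IntegrableOn f (Icc a b ×ˢ Ioo c d) :=
    h1.congr_fun (fun q hq => (hf q hq).symm) (measurableSet_Icc.prod measurableSet_Ioo)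
  exact h2.congr_set_ae (Measure.set_prod_ae_eq (ae_eq_refl _) Ioo_ae_eq_Icc.symm)

/-! ### The elliptic integral -/

theorem speed_neg (t : ℝ) : speed (-t) = speed t := by simp [speed]

theorem speed_add_pi (t : ℝ) : speed (t + π) = speed t := by simp [speed]

theorem integral_symm_of_even {f : ℝ → ℝ} (hf : Continuous f) (he : ∀ t, f (-t) = f t) (a : ℝ) :
    ∫ t in (-a)..a, f t = 2 * ∫ t in (0 : ℝ)..a, f t := by
  have h : ∫ t in (-a)..0, f t = ∫ t in (0 : ℝ)..a, f t := by
    have := intervalIntegral.integral_comp_neg (a := 0) (b := a) f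
    simp only [he, neg_zero] at this
    exact this.symm
  rw [← intervalIntegral.integral_add_adjacent_intervals (hf.intervalIntegrable (-a) 0)
    (hf.intervalIntegrable 0 a), h, two_mul]

theorem integral_symm_of_odd {f : ℝ → ℝ} (ho : ∀ t, f (-t) = -f t) (a : ℝ) :
    ∫ t in (-a)..a, f t = 0 := by
  have := intervalIntegral.integral_comp_neg (a := -a) (b := a) f
  simp only [ho, intervalIntegral.integral_neg, neg_neg] at this
  linarith

theorem integral_speed : ∫ t in (0 : ℝ)..(π / 2), speed t = ellipticE (1 / 2) := by
  rw [ellipticE]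
  congr 1
  funext t
  rw [speed]
  congr 1
  ring

theorem integral_symm_speed :
    ∫ t in (-(π / 2))..(π / 2), √2 * speed t = 2 * √2 * ellipticE (1 / 2) := by
  rw [intervalIntegral.integral_const_mul, integral_symm_of_even continuous_speed speed_neg,
    integral_speed]
  ring

theorem integral_add_integral_half_turn :
    (∫ t in (-(π / 2))..(π / 2), (1 + cos t) * (√2 * speed t))
      + (∫ t in (-(π / 2))..(π / 2), (1 - cos t) * (√2 * speed t))
      = 4 * √2 * ellipticE (1 / 2) := by
  have hs := continuous_speed
  rw [← intervalIntegral.integral_add (Continuous.intervalIntegrable (by fun_prop) _ _)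
    (Continuous.intervalIntegrable (by fun_prop) _ _)]
  have : ∀ t, (1 + cos t) * (√2 * speed t) + (1 - cos t) * (√2 * speed t)
      = 2 * (√2 * speed t) := fun t => by ring
  simp_rw [this]
  rw [intervalIntegral.integral_const_mul, integral_symm_speed]
  ring

/-- By periodicity the integral runs over `[-π/2, 3π/2]`. Shifting its second half by `π` preserves
`speed` and flips the sign of `cos`. The two halves are also the `phi` and `psi` integrals. -/
theorem integral_curved :
    ∫ t in (-π)..π, √2 * (1 + cos t) * speed t = 4 * √2 * ellipticE (1 / 2) := by
  have hs := continuous_speed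
  set f : ℝ → ℝ := fun t => √2 * (1 + cos t) * speed t
  have hc : Continuous f := by fun_prop
  have hper : Function.Periodic f (2 * π) := by
    intro t
    have : speed (t + 2 * π) = speed t := by
      rw [two_mul, ← add_assoc, speed_add_pi, speed_add_pi]
    simp only [f, cos_add_two_pi, this]
  have e1 : ∫ t in (-π)..π, f t = ∫ t in (-(π / 2))..(-(π / 2) + 2 * π), f t := by
    have := hper.intervalIntegral_add_eq (-π) (-(π / 2))
    rwa [show -π + 2 * π = π by ring] at this
  have e2 : ∫ t in (π / 2)..(-(π / 2) + 2 * π), f t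
      = ∫ t in (-(π / 2))..(π / 2), (1 - cos t) * (√2 * speed t) := by
    have := intervalIntegral.integral_comp_add_right (a := -(π / 2)) (b := π / 2) f π
    rw [show -(π / 2) + π = π / 2 by ring, show π / 2 + π = -(π / 2) + 2 * π by ring] at this
    rw [← this]
    congr 1
    funext t
    simp only [f, speed_add_pi, cos_add_pi]
    ring
  rw [e1, ← intervalIntegral.integral_add_adjacent_intervals (b := π / 2)
    (hc.intervalIntegrable _ _) (hc.intervalIntegrable _ _), e2, ← integral_add_integral_half_turn]
  congr 2
  funext t
  simp only [f]
  ring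

/-! ### The graph description -/

/-- The common area element of the graphs of `phi` and `psi`. -/
def areaWeight (x : ℝ) : ℝ := √(2 + x ^ 2 / (1 - x ^ 2))

theorem one_sub_sq_pos {x : ℝ} (hx : x ∈ Ioo (-1 : ℝ) 1) : 0 < 1 - x ^ 2 := by
  nlinarith [hx.1, hx.2]

theorem hasDerivAt_sqrt_one_sub_sq {x : ℝ} (hx : x ∈ Ioo (-1 : ℝ) 1) :
    HasDerivAt (fun s => √(1 - s ^ 2)) (-x / √(1 - x ^ 2)) x := by
  have h := one_sub_sq_pos hx
  have h1 : HasDerivAt (fun s : ℝ => 1 - s ^ 2) (-(2 * x)) x := by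
    simpa using (hasDerivAt_pow 2 x).const_sub 1
  convert h1.sqrt h.ne' using 1
  have := (sqrt_pos.2 h).ne'
  field_simp

theorem graphAreaElement_phi {x : ℝ} (hx : x ∈ Ioo (-1 : ℝ) 1) (y : ℝ) :
    graphAreaElement phi x y = areaWeight x := by
  have h := one_sub_sq_pos hx
  have h1 : deriv (fun s => phi s y) x = -x / √(1 - x ^ 2) :=
    (((hasDerivAt_sqrt_one_sub_sq hx).add_const y).sub_const 1).deriv
  have h2 : deriv (fun t => phi x t) y = 1 :=
    (((hasDerivAt_id y).const_add (√(1 - x ^ 2))).sub_const 1).deriv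
  rw [graphAreaElement, h1, h2, areaWeight, div_pow, sq_sqrt h.le]
  congr 1
  ring

theorem graphAreaElement_psi {x : ℝ} (hx : x ∈ Ioo (-1 : ℝ) 1) (y : ℝ) :
    graphAreaElement psi x y = areaWeight x := by
  have h := one_sub_sq_pos hx
  have h1 : deriv (fun s => psi s y) x = -(-x / √(1 - x ^ 2)) :=
    (((hasDerivAt_sqrt_one_sub_sq hx).neg.add_const y).sub_const 1).deriv
  have h2 : deriv (fun t => psi x t) y = 1 :=
    (((hasDerivAt_id y).const_add (-√(1 - x ^ 2))).sub_const 1).deriv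
  rw [graphAreaElement, h1, h2, areaWeight, neg_sq, div_pow, sq_sqrt h.le]
  congr 1
  ring

/-- Under the root, `cos² t (2 + tan² t) = 2 - sin² t`. -/
theorem cos_mul_areaWeight_sin {t : ℝ} (ht : t ∈ Ioo (-(π / 2)) (π / 2)) :
    cos t * areaWeight (sin t) = √2 * speed t := by
  have hc := cos_pos_of_mem_Ioo ht
  rw [areaWeight, speed, ← sqrt_mul (by norm_num), ← cos_sq']
  nth_rewrite 1 [← sqrt_sq hc.le]
  rw [← sqrt_mul (sq_nonneg _)]
  congr 1
  field_simp
  linarith [sin_sq_add_cos_sq t]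

theorem integrableOn_areaWeight : IntegrableOn areaWeight (Ioo (-1) 1) :=
  integrableOn_of_cos_mul_comp_sin (h := fun t => √2 * speed t)
    (continuous_const.mul continuous_speed) fun _ ht => cos_mul_areaWeight_sin ht

theorem integrableOn_phi :
    IntegrableOn (fun q : ℝ × ℝ => graphAreaElement phi q.1 q.2) phiDomain :=
  (integrableOn_prod_of_fst (c := -1) (d := 1) integrableOn_areaWeight fun _ hq =>
    graphAreaElement_phi hq.1 _).mono_set fun _ hq => ⟨abs_le.1 hq.1, abs_le.1 hq.2.1⟩

theorem integrableOn_psi :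
    IntegrableOn (fun q : ℝ × ℝ => graphAreaElement psi q.1 q.2) psiDomain :=
  (integrableOn_prod_of_fst (c := -1) (d := 1) integrableOn_areaWeight fun _ hq =>
    graphAreaElement_psi hq.1 _).mono_set fun _ hq => ⟨abs_le.1 hq.1, abs_le.1 hq.2.1⟩

theorem integral_graph_phi :
    ∫ x in (-1 : ℝ)..1, ∫ y in (-√(1 - x ^ 2))..1, graphAreaElement phi x y
      = ∫ t in (-(π / 2))..(π / 2), (1 + cos t) * (√2 * speed t) := by
  rw [integral_congr_Ioo (g := fun x => (1 + √(1 - x ^ 2)) * areaWeight x) (by norm_num),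
    integral_eq_integral_cos_mul_comp_sin]
  · refine integral_congr_Ioo (by linarith [pi_pos]) fun t ht => ?_
    rw [← cos_mul_areaWeight_sin ht, ← cos_sq', sqrt_sq (cos_pos_of_mem_Ioo ht).le]
    ring
  · intro x hx
    simp_rw [graphAreaElement_phi hx]
    rw [intervalIntegral.integral_const, smul_eq_mul, sub_neg_eq_add]

theorem integral_graph_psi :
    ∫ x in (-1 : ℝ)..1, ∫ y in √(1 - x ^ 2)..1, graphAreaElement psi x y
      = ∫ t in (-(π / 2))..(π / 2), (1 - cos t) * (√2 * speed t) := by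
  rw [integral_congr_Ioo (g := fun x => (1 - √(1 - x ^ 2)) * areaWeight x) (by norm_num),
    integral_eq_integral_cos_mul_comp_sin]
  · refine integral_congr_Ioo (by linarith [pi_pos]) fun t ht => ?_
    rw [← cos_mul_areaWeight_sin ht, ← cos_sq', sqrt_sq (cos_pos_of_mem_Ioo ht).le]
    ring
  · intro x hx
    simp_rw [graphAreaElement_psi hx]
    rw [intervalIntegral.integral_const, smul_eq_mul]

/-! ### Vinzant's parametrisation -/

theorem hasDerivAt_vec3 {a b c : ℝ → ℝ} {a' b' c' x : ℝ} (ha : HasDerivAt a a' x)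
    (hb : HasDerivAt b b' x) (hc : HasDerivAt c c' x) :
    HasDerivAt (fun s => (!₂[a s, b s, c s] : EuclideanSpace ℝ (Fin 3))) !₂[a', b', c'] x := by
  have h : HasDerivAt (fun s => (![a s, b s, c s] : Fin 3 → ℝ)) ![a', b', c'] x := by
    rw [hasDerivAt_pi]
    intro i
    fin_cases i
    · exact ha
    · exact hb
    · exact hc
  exact ((PiLp.continuousLinearEquiv 2 ℝ (fun _ : Fin 3 => ℝ)).symm :
    (Fin 3 → ℝ) →L[ℝ] EuclideanSpace ℝ (Fin 3)).hasFDerivAt.comp_hasDerivAt x h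

theorem paramU_eq (u v : ℝ) : paramU u v = !₂[0, -1 + v, -1 + v] := by
  refine (hasDerivAt_vec3 (hasDerivAt_const _ _) ?_ ?_).deriv
  · simpa using ((hasDerivAt_id u).const_sub 1).fun_add ((hasDerivAt_id u).mul_const v)
  · simpa using ((hasDerivAt_id u).neg.sub_const v).fun_add ((hasDerivAt_id u).mul_const v)

theorem paramV_eq (u : ℝ) {v : ℝ} (hv : v ∈ Ioo (-1 : ℝ) 1) :
    paramV u v = !₂[-v / √(1 - v ^ 2), u, -1 + u] := by
  refine (hasDerivAt_vec3 (hasDerivAt_sqrt_one_sub_sq hv) ?_ ?_).deriv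
  · simpa using ((hasDerivAt_id v).const_mul u).const_add (1 - u)
  · simpa using ((hasDerivAt_id v).const_sub (-u)).fun_add ((hasDerivAt_id v).const_mul u)

theorem coeff_det (u : ℝ) {v : ℝ} (hv : v ∈ Ioo (-1 : ℝ) 1) :
    coeffE u v * coeffG u v - coeffF u v ^ 2 = (1 - v) * (1 + v ^ 2) / (1 + v) := by
  have h := one_sub_sq_pos hv
  have h1 : 1 + v ≠ 0 := by linarith [hv.1]
  have h2 : 1 - v ≠ 0 := by linarith [hv.2]
  have hs : (-v / √(1 - v ^ 2)) ^ 2 = v ^ 2 / ((1 - v) * (1 + v)) := by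
    rw [div_pow, neg_sq, sq_sqrt h.le]; congr 1; ring
  have eE : coeffE u v = 2 * (1 - v) ^ 2 := by
    rw [coeffE, paramU_eq, PiLp.inner_apply, Fin.sum_univ_three]
    simp
    ring
  have eF : coeffF u v = (v - 1) * (2 * u - 1) := by
    rw [coeffF, paramU_eq, paramV_eq u hv, PiLp.inner_apply, Fin.sum_univ_three]
    simp
    ring
  have eG : coeffG u v = v ^ 2 / ((1 - v) * (1 + v)) + u ^ 2 + (u - 1) ^ 2 := by
    rw [coeffG, paramV_eq u hv, ← hs, PiLp.inner_apply, Fin.sum_univ_three]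
    simp [div_pow, sq_abs]
    ring
  rw [eE, eF, eG]
  field_simp
  ring

/-- The area element of the parametrisation, as a function of `v` alone. -/
def paramWeight (v : ℝ) : ℝ := √((1 - v) * (1 + v ^ 2) / (1 + v))

theorem paramAreaElement_eq (u : ℝ) {v : ℝ} (hv : v ∈ Ioo (-1 : ℝ) 1) :
    paramAreaElement u v = paramWeight v := by
  rw [paramAreaElement, coeff_det u hv, paramWeight]

theorem cos_mul_paramWeight_sin {t : ℝ} (ht : t ∈ Ioo (-(π / 2)) (π / 2)) :
    cos t * paramWeight (sin t) = (1 - sin t) * √(1 + sin t ^ 2) := by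
  have hc := cos_pos_of_mem_Ioo ht
  have hm := mapsTo_sin_Ioo ht
  have h1 : 0 < 1 + sin t := by linarith [hm.1]
  have h2 : 0 ≤ 1 - sin t := by linarith [hm.2]
  rw [paramWeight, ← sqrt_sq hc.le, ← sqrt_mul (sq_nonneg _), cos_sq']
  conv_rhs => rw [← sqrt_sq h2, ← sqrt_mul (sq_nonneg _)]
  congr 1
  field_simp
  ring

theorem integrableOn_paramWeight : IntegrableOn paramWeight (Ioo (-1) 1) :=
  integrableOn_of_cos_mul_comp_sin (h := fun t => (1 - sin t) * √(1 + sin t ^ 2))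
    (by fun_prop) fun _ ht => cos_mul_paramWeight_sin ht

theorem integrableOn_paramAreaElement :
    IntegrableOn (fun w : ℝ × ℝ => paramAreaElement w.1 w.2) (Icc 0 1 ×ˢ Icc (-1) 1) :=
  integrableOn_prod_of_snd integrableOn_paramWeight fun q hq => paramAreaElement_eq q.1 hq.2

theorem integral_paramAreaElement (u : ℝ) :
    ∫ v in (-1 : ℝ)..1, paramAreaElement u v = ∫ v in (-1 : ℝ)..1, paramWeight v :=
  integral_congr_Ioo (by norm_num) fun _ hv => paramAreaElement_eq u hv

/-- After `v = sin t` the integrand is `(1 - sin t) √(1 + sin² t)`, whose odd part integrates to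
zero. The reflection `t ↦ π/2 - t` turns the even part into `√2 * speed`. -/
theorem integral_paramWeight :
    ∫ v in (-1 : ℝ)..1, paramWeight v = 2 * √2 * ellipticE (1 / 2) := by
  rw [integral_eq_integral_cos_mul_comp_sin, integral_congr_Ioo (by linarith [pi_pos])
    fun t ht => cos_mul_paramWeight_sin ht]
  have hc : Continuous fun t => √(1 + sin t ^ 2) := by fun_prop
  have e : ∀ t, (1 - sin t) * √(1 + sin t ^ 2) = √(1 + sin t ^ 2) - sin t * √(1 + sin t ^ 2) :=
    fun t => by ring
  simp_rw [e]
  rw [intervalIntegral.integral_sub (hc.intervalIntegrable _ _)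
    (Continuous.intervalIntegrable (by fun_prop) _ _),
    integral_symm_of_odd (f := fun t => sin t * √(1 + sin t ^ 2)) (fun t => by simp),
    integral_symm_of_even hc (fun t => by simp), sub_zero, ← integral_speed, mul_assoc,
    ← intervalIntegral.integral_const_mul √2]
  have := intervalIntegral.integral_comp_sub_left (a := 0) (b := π / 2)
    (fun t => √2 * speed t) (π / 2)
  rw [sub_self, sub_zero] at this
  rw [← this]
  congr 2
  funext t
  rw [speed, sin_pi_div_two_sub, ← sqrt_mul (by norm_num)]
  congr 1
  rw [cos_sq']
  ring

theorem param_image :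
    (fun w : ℝ × ℝ => param w.1 w.2) '' (Icc 0 1 ×ˢ Icc (-1) 1) = curved ∩ {p | 0 ≤ p 0} := by
  ext p
  constructor
  · rintro ⟨⟨u, v⟩, ⟨⟨hu0, hu1⟩, ⟨hv0, hv1⟩⟩, rfl⟩
    dsimp only at hu0 hu1 hv0 hv1
    have hsq : √(1 - v ^ 2) ^ 2 = 1 - v ^ 2 := sq_sqrt (by nlinarith)
    refine ⟨(mem_curved_iff _).2 ⟨?_, ?_, ?_⟩, ?_⟩
    · simp [param]
      rw [hsq]; ring
    · simp [param]
      nlinarith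
    · simp [param]
      nlinarith
    · simp [param]
  · rintro ⟨hp, hx⟩
    rw [mem_ofPred_eq] at hx
    obtain ⟨h1, hz, hy⟩ := (mem_curved_iff p).1 hp
    obtain ⟨v, hv⟩ : ∃ v, v = -(p 2 - p 1 + 1) := ⟨_, rfl⟩
    have hw := abs_le.1 (abs_le_one_of_sq_add_sq_le_one (a := p 2 - p 1 + 1) (b := p 0)
      (by linarith))
    have hv0 : -1 ≤ v := by linarith
    have hv1 : v ≤ 1 := by linarith
    have hs : √(1 - v ^ 2) = p 0 := by
      rw [← sqrt_sq hx]; congr 1; rw [hv]; linarith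
    -- `u` measures the position along the ruling from `y = 1` to `z = -1`. At `v = 1` the ruling is
    -- a single point and any `u` serves.
    have key : ∃ u ∈ Icc (0 : ℝ) 1, u * (1 - v) = 1 - p 1 := by
      rcases hv1.eq_or_lt with h | h
      · exact ⟨0, by simp, by linarith⟩
      · refine ⟨(1 - p 1) / (1 - v), ⟨?_, ?_⟩, ?_⟩
        · exact div_nonneg (by linarith) (by linarith)
        · rw [div_le_one (by linarith)]; linarith
        · exact div_mul_cancel₀ _ (by linarith)
    obtain ⟨u, hu, huv⟩ := key
    refine ⟨(u, v), ⟨hu, ⟨hv0, hv1⟩⟩, PiLp.ext fun i => ?_⟩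
    fin_cases i
    · simp [param, hs]
    · simp [param]; linarith
    · simp [param]; linarith

/-! ### Bounds for `π` -/

theorem abs_arctan_sub_sum_le {x : ℝ} (hx : 0 ≤ x) (hx' : x < 1) (N : ℕ) :
    |(∑ n ∈ Finset.range N, (-1) ^ n * x ^ (2 * n + 1) / ((2 * n + 1 : ℕ) : ℝ)) - arctan x|
      ≤ x * (x ^ 2) ^ N / (1 - x ^ 2) := by
  have hs := Real.hasSum_arctan (x := x) (by rw [norm_of_nonneg hx]; exact hx')
  refine norm_sub_le_of_geometric_bound_of_hasSum (by nlinarith) (fun n => ?_) hs N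
  rw [norm_div, norm_mul, norm_pow, norm_neg, norm_one, one_pow, one_mul, norm_pow,
    norm_of_nonneg hx, pow_succ, pow_mul, mul_comm]
  refine div_le_self (by positivity) ?_
  rw [Real.norm_natCast]
  push_cast
  linarith [(Nat.cast_nonneg n : (0 : ℝ) ≤ n)]

theorem pi_bounds : (3.14159265358979323846264338327 : ℝ) < π ∧ π < 3.14159265358979323846264338328 := by
  have hm := four_mul_arctan_inv_5_sub_arctan_inv_239
  -- The truncation errors are of order `5⁻⁴⁷` and `239⁻¹⁵`, both below `10⁻³²`.
  have h5 := abs_le.1 (abs_arctan_sub_sum_le (x := 5⁻¹) (by norm_num) (by norm_num) 23)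
  have h239 := abs_le.1 (abs_arctan_sub_sum_le (x := 239⁻¹) (by norm_num) (by norm_num) 7)
  norm_num [Finset.sum_range_succ] at h5 h239 hm ⊢
  constructor <;> linarith [h5.1, h5.2, h239.1, h239.2]

/-! ### The binomial series of the square root -/

theorem choose_half_succ (n : ℕ) :
    Ring.choose (1 / 2 : ℝ) (n + 1) = (1 / 2 - n) / (n + 1) * Ring.choose (1 / 2 : ℝ) n := by
  have := Ring.choose_smul_choose (1 / 2 : ℝ) (Nat.le_succ n)
  simp only [Nat.succ_eq_add_one, Nat.choose_succ_self_right, Nat.add_sub_cancel_left,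
    Ring.choose_one_right, nsmul_eq_mul, Nat.cast_add, Nat.cast_one] at this
  have hn : (n : ℝ) + 1 ≠ 0 := by positivity
  field_simp at this ⊢
  linarith

theorem abs_choose_half_le_one (n : ℕ) : |Ring.choose (1 / 2 : ℝ) n| ≤ 1 := by
  induction n with
  | zero => simp
  | succ n ih =>
    rw [choose_half_succ, abs_mul]
    refine mul_le_one₀ ?_ (abs_nonneg _) ih
    have hn : (0 : ℝ) ≤ n := Nat.cast_nonneg n
    rw [abs_le]
    constructor
    · rw [le_div_iff₀ (by positivity)]; linarith
    · rw [div_le_one (by positivity)]; linarith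

theorem hasSum_sqrt_one_add {w : ℝ} (hw : |w| < 1) :
    HasSum (fun n => Ring.choose (1 / 2 : ℝ) n * w ^ n) √(1 + w) := by
  have h := (Real.one_add_rpow_hasFPowerSeriesOnBall_zero (a := 1 / 2)).hasSum (y := w)
    (by simpa [enorm_eq_nnnorm, ← NNReal.coe_lt_coe] using hw)
  simpa [-FormalMultilinearSeries.apply_eq_prod_smul_coeff, binomialSeries_apply,
    sqrt_eq_rpow] using h

/-- The coefficients are at most `1` in absolute value, so a geometric tail dominates; `3 / 2` is `1
/ (1 - 1 / 3)`. -/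
theorem abs_sqrt_one_add_sub_sum_le {w : ℝ} (hw : |w| ≤ 1 / 3) (N : ℕ) :
    |√(1 + w) - ∑ n ∈ Finset.range N, Ring.choose (1 / 2 : ℝ) n * w ^ n|
      ≤ 3 / 2 * (1 / 3) ^ N := by
  have hs := hasSum_sqrt_one_add (w := w) (by linarith)
  have := norm_sub_le_of_geometric_bound_of_hasSum (r := 1 / 3) (C := 1) (by norm_num)
    (fun n => ?_) hs N
  · rw [norm_sub_rev, norm_eq_abs] at this
    refine this.trans_eq ?_
    ring
  · rw [norm_mul, norm_pow, norm_eq_abs, norm_eq_abs]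
    exact mul_le_mul (abs_choose_half_le_one n) (pow_le_pow_left₀ (abs_nonneg _) hw n)
      (by positivity) zero_le_one

/-! ### Termwise integration -/

theorem integral_cos_pow_zero_pi_add_two (n : ℕ) :
    ∫ x in (0 : ℝ)..π, cos x ^ (n + 2) = (n + 1) / (n + 2) * ∫ x in (0 : ℝ)..π, cos x ^ n := by
  rw [integral_cos_pow]
  simp

theorem integral_cos_pow_odd (k : ℕ) : ∫ x in (0 : ℝ)..π, cos x ^ (2 * k + 1) = 0 := by
  induction k with
  | zero => simp
  | succ k ih =>
    rw [show 2 * (k + 1) + 1 = 2 * k + 1 + 2 by ring, integral_cos_pow_zero_pi_add_two, ih,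
      mul_zero]

/-- The terms of the series for the mean of `√(1 + cos φ / 3)`. -/
def meanTerm (k : ℕ) : ℝ :=
  Ring.choose (1 / 2 : ℝ) (2 * k) * (1 / 3) ^ (2 * k) * ((∫ x in (0 : ℝ)..π, cos x ^ (2 * k)) / π)

theorem meanTerm_zero : meanTerm 0 = 1 := by
  simp [meanTerm, pi_ne_zero]

/-- The ratio of consecutive terms. -/
def meanRatio (k : ℝ) : ℝ := (4 * k - 1) * (4 * k + 1) / (144 * (k + 1) ^ 2)

theorem meanTerm_succ (k : ℕ) : meanTerm (k + 1) = meanRatio k * meanTerm k := by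
  have hk : (k : ℝ) + 1 ≠ 0 := by positivity
  have hk' : 2 * (k : ℝ) + 1 ≠ 0 := by positivity
  rw [meanTerm, show 2 * (k + 1) = 2 * k + 1 + 1 by ring, choose_half_succ, choose_half_succ,
    integral_cos_pow_zero_pi_add_two, meanTerm, meanRatio]
  push_cast
  rw [show (2 * (k : ℝ) + 1 + 1) = 2 * (k + 1) by ring,
    show (2 * (k : ℝ) + 2) = 2 * (k + 1) by ring]
  field_simp
  ring

/-- Horner's scheme for the partial sums of the series. -/
def meanHorner : ℕ → ℝ → ℝ
  | 0, _ => 0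
  | n + 1, k => 1 + meanRatio k * meanHorner n (k + 1)

/-- Consecutive terms have a rational ratio and `meanTerm 0 = 1`, so the partial sums become
explicit rationals. The starting index is general for the induction. -/
theorem sum_meanTerm (n k : ℕ) :
    ∑ i ∈ Finset.range n, meanTerm (k + i) = meanTerm k * meanHorner n k := by
  induction n generalizing k with
  | zero => simp [meanHorner]
  | succ n ih =>
    have := ih (k + 1)
    rw [Finset.sum_range_succ', meanHorner]
    rw [Finset.sum_congr rfl fun i _ => congrArg meanTerm (show k + (i + 1) = k + 1 + i by ring),
      this, meanTerm_succ]
    push_cast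
    ring_nf

/-- Odd powers of `cos` integrate to zero over `[0, π]`, so half of the terms drop out. -/
theorem sum_range_two_mul_choose_half (K : ℕ) :
    ∑ n ∈ Finset.range (2 * K),
        Ring.choose (1 / 2 : ℝ) n * (1 / 3) ^ n * (∫ x in (0 : ℝ)..π, cos x ^ n)
      = π * ∑ k ∈ Finset.range K, meanTerm k := by
  induction K with
  | zero => simp
  | succ K ih =>
    rw [show 2 * (K + 1) = 2 * K + 1 + 1 by ring, Finset.sum_range_succ, Finset.sum_range_succ, ih,
      integral_cos_pow_odd, Finset.sum_range_succ, meanTerm]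
    have := pi_ne_zero
    field_simp
    ring

theorem abs_integral_sqrt_sub_le (K : ℕ) :
    |(∫ x in (0 : ℝ)..π, √(1 + cos x / 3)) - π * meanHorner K 0| ≤ 3 / 2 * (1 / 9) ^ K * π := by
  have hsum : π * meanHorner K 0 = ∫ x in (0 : ℝ)..π,
      ∑ n ∈ Finset.range (2 * K), Ring.choose (1 / 2 : ℝ) n * (cos x / 3) ^ n := by
    have h1 := sum_meanTerm K 0
    simp only [zero_add, meanTerm_zero, one_mul, Nat.cast_zero] at h1
    rw [← h1, ← sum_range_two_mul_choose_half, intervalIntegral.integral_finsetSum]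
    · refine Finset.sum_congr rfl fun n _ => ?_
      rw [← intervalIntegral.integral_const_mul]
      congr 1
      funext x
      ring
    · exact fun n _ => Continuous.intervalIntegrable (by fun_prop) _ _
  rw [hsum, ← intervalIntegral.integral_sub (Continuous.intervalIntegrable (by fun_prop) _ _)
    (Continuous.intervalIntegrable (by fun_prop) _ _)]
  have := intervalIntegral.norm_integral_le_of_norm_le_const (a := 0) (b := π)
    (f := fun x => √(1 + cos x / 3)
      - ∑ n ∈ Finset.range (2 * K), Ring.choose (1 / 2 : ℝ) n * (cos x / 3) ^ n)
    (C := 3 / 2 * (1 / 3) ^ (2 * K)) fun x _ => by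
      refine abs_sqrt_one_add_sub_sum_le ?_ _
      rw [abs_div, abs_of_pos (by norm_num : (0 : ℝ) < 3)]
      linarith [abs_cos_le_one x]
  rw [sub_zero, abs_of_pos pi_pos, pow_mul] at this
  norm_num at this ⊢
  exact this

/-- With `x = 2t`, `2 - sin² t = (3/2)(1 + cos x / 3)`: centring the radicand gives a series with
ratio `1/3`. -/
theorem two_mul_sqrt_two_mul_ellipticE :
    2 * √2 * ellipticE (1 / 2) = √(3 / 2) * ∫ x in (0 : ℝ)..π, √(1 + cos x / 3) := by
  rw [← integral_speed, mul_comm 2 √2, mul_assoc, ← intervalIntegral.integral_const_mul,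
    ← intervalIntegral.integral_const_mul, ← intervalIntegral.integral_const_mul]
  have := intervalIntegral.integral_comp_mul_left (a := 0) (b := π / 2)
    (fun x => √(3 / 2) * √(1 + cos x / 3)) (c := 2) (by norm_num)
  rw [mul_zero, mul_div_cancel₀ _ (two_ne_zero : (2 : ℝ) ≠ 0), smul_eq_mul] at this
  rw [← mul_right_inj' (show (2⁻¹ : ℝ) ≠ 0 by norm_num), ← this,
    ← intervalIntegral.integral_const_mul]
  congr 1
  funext t
  rw [speed, ← sqrt_mul (by norm_num), cos_two_mul, cos_sq']
  have : √2 * √(1 - sin t ^ 2 / 2) = √(3 / 2 * (1 + (2 * (1 - sin t ^ 2) - 1) / 3)) := by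
    rw [← sqrt_mul (by norm_num)]
    congr 1
    ring
  linarith

theorem meanHorner_bounds :
    (0.9928653320616229704933986333 : ℝ) + 3 / 2 * (1 / 9) ^ 30 ≤ meanHorner 30 0 ∧
      meanHorner 30 0 + 3 / 2 * (1 / 9) ^ 30 ≤ 0.9928653320616229704933986336 := by
  -- Thirty even terms leave a tail `(3/2) 9⁻³⁰ < 4·10⁻²⁹`, well inside the window of width
  -- `3·10⁻²⁸`.
  simp only [meanHorner, meanRatio]
  norm_num

theorem area_bounds :
    (13.9235808852350105127348109 : ℝ) < 2 * (π + 2 * √2 * ellipticE (1 / 2)) ∧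
      2 * (π + 2 * √2 * ellipticE (1 / 2)) < (13.9235808852350105127348110 : ℝ) := by
  obtain ⟨p1, p2⟩ := pi_bounds
  have hI := abs_le.1 (abs_integral_sqrt_sub_le 30)
  obtain ⟨x1, x2⟩ := meanHorner_bounds
  have r1 : (1.22474487139158904909864203735 : ℝ) ≤ √(3 / 2) := le_sqrt_of_sq_le (by norm_num)
  have r2 : √(3 / 2) ≤ 1.22474487139158904909864203736 := sqrt_le_iff.2 ⟨by norm_num, by norm_num⟩
  rw [two_mul_sqrt_two_mul_ellipticE]
  set I := ∫ x in (0 : ℝ)..π, √(1 + cos x / 3)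
  have i1 : 0.9928653320616229704933986333 * 3.14159265358979323846264338327 ≤ I := by
    refine le_trans ?_ (show π * (meanHorner 30 0 - 3 / 2 * (1 / 9) ^ 30) ≤ I by linarith [hI.1])
    rw [mul_comm]
    exact mul_le_mul p1.le (by linarith) (by norm_num) pi_pos.le
  have i2 : I ≤ 0.9928653320616229704933986336 * 3.14159265358979323846264338328 := by
    refine le_trans (show I ≤ π * (meanHorner 30 0 + 3 / 2 * (1 / 9) ^ 30) by linarith [hI.2]) ?_
    rw [mul_comm]
    exact mul_le_mul x2 p2.le pi_pos.le (by norm_num)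
  have l := mul_le_mul r1 i1 (by norm_num) (sqrt_nonneg _)
  have u := mul_le_mul r2 i2 ((by norm_num : (0 : ℝ) ≤ 0.9928653320616229704933986333 * 3.14159265358979323846264338327).trans i1) (by norm_num)
  constructor
  · norm_num at l p1 ⊢
    linarith
  · norm_num at u p2 ⊢
    linarith

end TwoDisks

end

theorem mainTheorem5 :
    -- the surface area, in closed form and numerically
    TwoDisks.surfaceArea TwoDisks.body
        = ENNReal.ofReal (2 * (π + 2 * √2 * TwoDisks.ellipticE (1 / 2))) ∧
    (13.9235808852350105127348109 : ℝ) < 2 * (π + 2 * √2 * TwoDisks.ellipticE (1 / 2)) ∧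
    2 * (π + 2 * √2 * TwoDisks.ellipticE (1 / 2)) < (13.9235808852350105127348110 : ℝ) ∧
    -- the graph description of the boundary and the resulting area formula
    frontier TwoDisks.body = TwoDisks.diskXY ∪ TwoDisks.diskXZ ∪ TwoDisks.curved ∧
    IntegrableOn (fun q : ℝ × ℝ => TwoDisks.graphAreaElement TwoDisks.phi q.1 q.2)
      TwoDisks.phiDomain ∧
    IntegrableOn (fun q : ℝ × ℝ => TwoDisks.graphAreaElement TwoDisks.psi q.1 q.2)
      TwoDisks.psiDomain ∧
    TwoDisks.surfaceArea TwoDisks.body = ENNReal.ofReal (2 * π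
        + (∫ x in (-1 : ℝ)..1, ∫ y in (-√(1 - x ^ 2))..1,
            TwoDisks.graphAreaElement TwoDisks.phi x y)
        + ∫ x in (-1 : ℝ)..1, ∫ y in √(1 - x ^ 2)..1,
            TwoDisks.graphAreaElement TwoDisks.psi x y) ∧
    2 * π
        + (∫ x in (-1 : ℝ)..1, ∫ y in (-√(1 - x ^ 2))..1,
            TwoDisks.graphAreaElement TwoDisks.phi x y)
        + (∫ x in (-1 : ℝ)..1, ∫ y in √(1 - x ^ 2)..1,
            TwoDisks.graphAreaElement TwoDisks.psi x y)
      = 2 * (π + 2 * √2 * TwoDisks.ellipticE (1 / 2)) ∧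
    -- Vinzant's parametrisation and the resulting area formula
    (fun w : ℝ × ℝ => TwoDisks.param w.1 w.2) '' (Icc 0 1 ×ˢ Icc (-1) 1)
      = TwoDisks.curved ∩ {p | 0 ≤ p 0} ∧
    (∀ u ∈ Icc (0 : ℝ) 1, ∀ v ∈ Ioo (-1 : ℝ) 1,
      TwoDisks.coeffE u v * TwoDisks.coeffG u v - TwoDisks.coeffF u v ^ 2
        = (1 - v) * (1 + v ^ 2) / (1 + v)) ∧
    IntegrableOn (fun w : ℝ × ℝ => TwoDisks.paramAreaElement w.1 w.2)
      (Icc 0 1 ×ˢ Icc (-1) 1) ∧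
    TwoDisks.surfaceArea TwoDisks.body = ENNReal.ofReal (2 * π
        + 2 * ∫ u in (0 : ℝ)..1, ∫ v in (-1 : ℝ)..1, TwoDisks.paramAreaElement u v) ∧
    2 * π + 2 * (∫ u in (0 : ℝ)..1, ∫ v in (-1 : ℝ)..1, TwoDisks.paramAreaElement u v)
      = 2 * π + 2 * (∫ _u in (0 : ℝ)..1, ∫ v in (-1 : ℝ)..1,
          √((1 - v) * (1 + v ^ 2) / (1 + v))) ∧
    2 * π + 2 * (∫ _u in (0 : ℝ)..1, ∫ v in (-1 : ℝ)..1,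
          √((1 - v) * (1 + v ^ 2) / (1 + v)))
      = 2 * (π + 2 * √2 * TwoDisks.ellipticE (1 / 2)) := by
  have hA : 2 * π + 4 * √2 * TwoDisks.ellipticE (1 / 2)
      = 2 * (π + 2 * √2 * TwoDisks.ellipticE (1 / 2)) := by ring
  have hS : TwoDisks.surfaceArea TwoDisks.body
      = ENNReal.ofReal (2 * (π + 2 * √2 * TwoDisks.ellipticE (1 / 2))) := by
    rw [TwoDisks.surfaceArea_body, TwoDisks.integral_curved, hA]
  have hG : 2 * π
        + (∫ x in (-1 : ℝ)..1, ∫ y in (-√(1 - x ^ 2))..1,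
            TwoDisks.graphAreaElement TwoDisks.phi x y)
        + (∫ x in (-1 : ℝ)..1, ∫ y in √(1 - x ^ 2)..1,
            TwoDisks.graphAreaElement TwoDisks.psi x y)
      = 2 * (π + 2 * √2 * TwoDisks.ellipticE (1 / 2)) := by
    rw [TwoDisks.integral_graph_phi, TwoDisks.integral_graph_psi, add_assoc,
      TwoDisks.integral_add_integral_half_turn, hA]
  have hP : (∫ u in (0 : ℝ)..1, ∫ v in (-1 : ℝ)..1, TwoDisks.paramAreaElement u v)
      = ∫ _u in (0 : ℝ)..1, ∫ v in (-1 : ℝ)..1, √((1 - v) * (1 + v ^ 2) / (1 + v)) := by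
    simp_rw [TwoDisks.integral_paramAreaElement]
    rfl
  have hV : 2 * π + 2 * (∫ _u in (0 : ℝ)..1, ∫ v in (-1 : ℝ)..1,
          √((1 - v) * (1 + v ^ 2) / (1 + v)))
      = 2 * (π + 2 * √2 * TwoDisks.ellipticE (1 / 2)) := by
    have := TwoDisks.integral_paramWeight
    simp only [TwoDisks.paramWeight] at this
    rw [intervalIntegral.integral_const, this, sub_zero, one_smul]
    ring
  exact ⟨hS, TwoDisks.area_bounds.1, TwoDisks.area_bounds.2, TwoDisks.frontier_body,
    TwoDisks.integrableOn_phi, TwoDisks.integrableOn_psi, by rw [hG, hS], hG,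
    TwoDisks.param_image, fun u _ _ hv => TwoDisks.coeff_det u hv,
    TwoDisks.integrableOn_paramAreaElement, by rw [hP, hV, hS], by rw [hP], hV⟩
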